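/- **Setting.** Let $F$ be a member of the semi-extended Selberg class $\mathcal S^{\sharp\flat}$. That is, $F$ is a function on $\mathbb C\setminus\{1\}$, not identically zero, such that: - (S1) $F(s)=\sum_{n\ge1}a_F(n)n^{-s}$ with absolute convergence for $\Re s>1$; - (S2) for some integer $m\ge0$ the function $(s-1)^mF(s)$ extends to an entire function of finite order; the smallest such $m$ is denoted $m_F$; - (S3) there are $r\ge0$, $Q>0$, $\lambda_j>0$, $\mu_j\in\mathbb C$ with $\Re\mu_j\ge0$ $(1\le j\le r)$ and $\omega\in\mathbb C$ with $|\omega|=1$ such that the meromorphic function (removable singularities removed) $$\xi_F(s)=s^{m_F}(s-1)^{m_F}Q^s\prod_{j=1}^r\Gamma(\lambda_js+\mu_j)\,F(s)$$ satisfies $\xi_F(s)=\omega\,\overline{\xi_F(1-\bar s)}$; - (S5') $-\dfrac{F'}{F}(s)=\sum_{n\ge2}c_F(n)n^{-s}$ with absolute convergence for $\Re s>1$. For data $(\omega,Q,r,\lambda_j,\mu_j)$ satisfying (S3), let $m_\gamma$ be the order of vanishing of $\xi_F$ at $\tfrac12-i\gamma$ (so $m_0=0$ if $\xi_F(\tfrac12)\ne0$),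 and let $$iB_F=\lim_{s\to1/2}\Big(\frac{\xi_F'}{\xi_F}(s)-\frac{m_0}{s-1/2}\Big),$$ which is $\frac{\xi_F'}{\xi_F}(\tfrac12)$ when $\xi_F(\tfrac12)\neq0$. The screw function of $F$ is $$g_F(t)=-iB_Ft-\frac{m_0}{2}t^2+\sum_{\gamma\ne0,\ \xi_F(1/2-i\gamma)=0}m_\gamma\frac{e^{-i\gamma t}-1}{\gamma^2}\quad(t\ge0),\qquad g_F(t)=\overline{g_F(-t)}\quad(t<0),$$ where the sum is over distinct $\gamma$. Put $\Phi(z,s,a)=\sum_{n\ge0}z^n(n+a)^{-s}$ (Lerch transcendent) and define, for $t\ge0$, $$\begin{aligned}\Phi_F(t)={}&4m_F(e^{t/2}+e^{-t/2}-2)-\sum_{2\le n\le e^t}\frac{c_F(n)}{\sqrt n}(t-\log n)+\Big[\log Q+\sum_{j=1}^r\lambda_j\frac{\Gamma'}{\Gamma}\Big(\frac{\lambda_j}2+\mu_j\Big)\Big]t\\&+\sum_{j=1}^r\lambda_j^2\Big[\Phi\Big(1,2,\frac{\lambda_j}2+\mu_j\Big)-e^{-t\left(\frac12+\frac{\mu_j}{\lambda_j}\right)}\Phi\Big(e^{-t/\lambda_j},2,\frac{\lambda_j}2+\mu_j\Big)\Big],\end{aligned}$$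 and $\Phi_F(t)=\overline{\Phi_F(-t)}$ for $t<0$. **Theorem 4.1.** For every choice of data in (S3), $\xi_F$ is entire, the limit defining $iB_F$ exists, the sum over zeros in $g_F(t)$ converges absolutely for every real $t$, and the Lerch series in $\Phi_F(t)$ converge absolutely for every $t\ge0$. Moreover $\Phi_F(t)$ is uniquely determined by $F$, i.e. it does not depend on the choice of the data $(\omega,Q,r,\lambda_j,\mu_j)$ in (S3) (nor of $c_F$ in (S5')), and $$\Phi_F(t)=-g_F(t)\qquad\text{for all real }t.$$ -/

import Mathlib

open Filter Topology Complex

noncomputable section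

namespace SelbergScrew

/-- `f` has finite order of growth: `f(s) = O(exp(|s|^ρ))` for some exponent `ρ`. -/
def HasFiniteOrder (f : ℂ → ℂ) : Prop :=
  ∃ (ρ : ℕ) (C : ℝ), ∀ s : ℂ, ‖f s‖ ≤ C * Real.exp (‖s‖ ^ ρ)

/-- `(s - 1)^m F(s)` extends to an entire function of finite order. A member of the Selberg class
is regarded as a function on `ℂ ∖ {1}`: its Lean value at `s = 1` plays no role anywhere. -/
def ExtendsWith (F : ℂ → ℂ) (m : ℕ) : Prop :=
  ∃ G : ℂ → ℂ, Differentiable ℂ G ∧ HasFiniteOrder G ∧ ∀ s : ℂ, s ≠ 1 → G s = (s - 1) ^ m * F s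

/-- The smallest `m ≥ 0` such that `(s - 1)^m F(s)` extends to an entire function of finite
order. -/
def poleOrder (F : ℂ → ℂ) : ℕ := sInf {m : ℕ | ExtendsWith F m}

/-- The parameters `(ω, Q, r, λ_j, μ_j)` of a functional equation. -/
structure GammaData where
  ω : ℂ
  Q : ℝ
  r : ℕ
  lam : Fin r → ℝ
  mu : Fin r → ℂ
  norm_ω : ‖ω‖ = 1
  Q_pos : 0 < Q
  lam_pos : ∀ j, 0 < lam j
  mu_re : ∀ j, 0 ≤ (mu j).re

/-- `γ(s) = Q^s ∏ Γ(λ_j s + μ_j)`. -/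
def GammaData.gammaFactor (D : GammaData) (s : ℂ) : ℂ :=
  (D.Q : ℂ) ^ s * ∏ j, Gamma (D.lam j * s + D.mu j)

/-- The product `s^{m_F} (s - 1)^{m_F} γ(s) F(s)`, meaningful away from `s = 1` and the poles of
the gamma factor. -/
def xiProduct (F : ℂ → ℂ) (D : GammaData) (s : ℂ) : ℂ :=
  s ^ poleOrder F * (s - 1) ^ poleOrder F * D.gammaFactor s * F s

/-- The function `ξ_F`: the product above as a meromorphic function on `ℂ`, with all removable
singularities removed. -/
def xi (F : ℂ → ℂ) (D : GammaData) : ℂ → ℂ :=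
  toMeromorphicNFOn (xiProduct F D) Set.univ

/-- The data `D` are admissible for `F`: `ξ_F(s) = ω conj (ξ_F(1 - conj s))`. -/
def FunctionalEquation (F : ℂ → ℂ) (D : GammaData) : Prop :=
  ∀ s : ℂ, xi F D s = D.ω * (starRingEnd ℂ) (xi F D (1 - (starRingEnd ℂ) s))

/-- The extended Selberg class: functions, not identically zero, given by an absolutely convergent
Dirichlet series for `Re s > 1`, with continuation and functional equation. -/
structure ExtendedSelbergClass (F : ℂ → ℂ) : Prop where
  not_zero : ∃ s : ℂ, s ≠ 1 ∧ F s ≠ 0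
  dirichlet_series : ∃ a : ℕ → ℂ, ∀ s : ℂ, 1 < s.re → LSeriesHasSum a s (F s)
  continuation : ∃ m : ℕ, ExtendsWith F m
  functional_equation : ∃ D : GammaData, FunctionalEquation F D

/-- `-F'/F(s) = ∑_{n ≥ 2} c(n) n^{-s}`, absolutely convergent for `Re s > 1`. -/
structure EulerSum (F : ℂ → ℂ) (c : ℕ → ℂ) : Prop where
  one : c 1 = 0
  hasSum : ∀ s : ℂ, 1 < s.re → LSeriesHasSum c s (-logDeriv F s)

/-- The semi-extended Selberg class. -/
structure SemiExtendedSelbergClass (F : ℂ → ℂ) : Prop extends ExtendedSelbergClass F where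
  euler_sum : ∃ c : ℕ → ℂ, EulerSum F c

/-- The set of nonzero `γ` such that `1/2 - iγ` is a zero of `ξ_F`. -/
def nonzeroZeros (F : ℂ → ℂ) (D : GammaData) : Set ℂ :=
  {γ : ℂ | γ ≠ 0 ∧ xi F D (1 / 2 - I * γ) = 0}

/-- The multiplicity `m_γ` of `1/2 - iγ` as a zero of `ξ_F` (it is `0` if this is no zero). -/
def mult (F : ℂ → ℂ) (D : GammaData) (γ : ℂ) : ℕ :=
  analyticOrderNatAt (xi F D) (1 / 2 - I * γ)

/-- `ξ_F'/ξ_F(s)` without its polar part `m_0 / (s - 1/2)` at `s = 1/2`. -/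
def xiLogDerivReg (F : ℂ → ℂ) (D : GammaData) (s : ℂ) : ℂ :=
  logDeriv (xi F D) s - mult F D 0 / (s - 1 / 2)

/-- The number `iB_F`: the value of `ξ_F'/ξ_F` at `1/2` if `ξ_F(1/2) ≠ 0`, and in general the
constant term of its Laurent expansion there, as in the Hadamard product of `ξ_F(1/2 - iz)`. -/
def iB (F : ℂ → ℂ) (D : GammaData) : ℂ :=
  limUnder (𝓝[≠] (1 / 2 : ℂ)) (xiLogDerivReg F D)

/-- The term `m_γ (e^{-iγt} - 1) / γ²`. -/
def zeroTerm (F : ℂ → ℂ) (D : GammaData) (t : ℝ) (γ : ℂ) : ℂ :=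
  mult F D γ * ((exp (-I * γ * t) - 1) / γ ^ 2)

/-- The expression of the screw function for `t ≥ 0`. -/
def screwFormula (F : ℂ → ℂ) (D : GammaData) (t : ℝ) : ℂ :=
  -iB F D * t - mult F D 0 / 2 * (t : ℂ) ^ 2 + ∑' γ : nonzeroZeros F D, zeroTerm F D t γ

/-- The screw function `g_F`. -/
def screw (F : ℂ → ℂ) (D : GammaData) (t : ℝ) : ℂ :=
  if 0 ≤ t then screwFormula F D t else (starRingEnd ℂ) (screwFormula F D (-t))

/-- The general term `z^n (n + a)^{-s}` of the Lerch transcendent. -/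
def lerchTerm (z s a : ℂ) (n : ℕ) : ℂ := z ^ n * ((n : ℂ) + a) ^ (-s)

/-- The Lerch transcendent `Φ(z, s, a) = ∑_{n ≥ 0} z^n (n + a)^{-s}`. -/
def lerch (z s a : ℂ) : ℂ := ∑' n : ℕ, lerchTerm z s a n

/-- The expression of `Φ_F` for `t ≥ 0`. -/
def phiFormula (F : ℂ → ℂ) (D : GammaData) (c : ℕ → ℂ) (t : ℝ) : ℂ :=
  4 * poleOrder F * (exp (t / 2) + exp (-t / 2) - 2)
  - ∑ n ∈ Finset.Icc 2 ⌊Real.exp t⌋₊, c n / (√(n : ℝ) : ℂ) * (t - Real.log n)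
  + (Real.log D.Q + ∑ j, D.lam j * digamma (D.lam j / 2 + D.mu j)) * t
  + ∑ j, (D.lam j : ℂ) ^ 2 *
      (lerch 1 2 (D.lam j / 2 + D.mu j)
        - exp (-t * (1 / 2 + D.mu j / D.lam j))
          * lerch (exp (-t / D.lam j)) 2 (D.lam j / 2 + D.mu j))

/-- The function `Φ_F`, extended to negative `t` by `Φ_F(t) = conj (Φ_F(-t))`. -/
def phi (F : ℂ → ℂ) (D : GammaData) (c : ℕ → ℂ) (t : ℝ) : ℂ :=
  if 0 ≤ t then phiFormula F D c t else (starRingEnd ℂ) (phiFormula F D c (-t))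

end SelbergScrew

end

/-! ### Local estimates for logarithmic derivatives; dividing out zeros. -/

noncomputable section
namespace SelbergScrew

/-! Both `phiFormula` and `screwFormula` are continuous on $[0,\infty)$, vanish at $0$ and grow at
most like $e^{\sigma t}$ for every $\sigma>1/2$, so it suffices to compare Laplace transforms on
$\Re w>1/2$. Up to sign, each transform is $w^{-2}\,\frac{\xi_F'}{\xi_F}(w+\tfrac12)$: the two
formulas are the two classical expansions of $\xi_F'/\xi_F$, integrated twice. The factor $w^{-2}$
makes every series absolutely convergent.

The common building block is `expKernel`, $(1-e^{-\beta t})/\beta^2$, whose transform is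
$w^{-2}(1/\beta-1/(w+\beta))$. Taking $\beta=i\gamma$ gives the zeros, $\beta=\pm\tfrac12$ the
factors $s^{m_F}(s-1)^{m_F}$, and $\beta=(n+\lambda_j/2+\mu_j)/\lambda_j$ the gamma factors through
the digamma series. The Dirichlet coefficients contribute shifted ramps $\max(t-\log n,0)$.

On the side of the zeros the input is the Hadamard partial fraction expansion
(`GenusOne.hasSum_logDeriv`). It is proved directly for entire functions bounded by
$\exp(B(1+|z|)^{3/2})$: divide out the zeros in a disc, and control what remains by
Borel–Carathéodory and Cauchy. Any exponent in $(1,2)$ would serve; $3/2$ spares the logarithm of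
Stirling's formula. The growth of $\xi_F$ (`exists_xi_le`) comes from the Dirichlet series on the
right, the functional equation on the left, and Phragmén–Lindelöf in between. Zeros lie in $0\le\Re
s\le1$ because the Dirichlet series for $F'/F$ excludes zeros of $F$ in $\Re s>1$; this strip is
what bounds the growth of the zero terms by $e^{t/2}$.

On the other side $\xi_F'/\xi_F$ is the sum of its explicit factors (`logDeriv_xi`). Uniqueness of
the Laplace transform (`HasLaplace.eq_zero`) finishes the identity.

For independence of the data, only the logarithmic derivative of the gamma factor can vary. The
difference for two choices satisfies a reflection formula, hence extends to an entire function with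
bounded derivative, so it is affine; the behaviour of the digamma function along the positive axis
forces it to vanish (`gammaLog_eq`). -/

theorem exists_log_ball {g : ℂ → ℂ} {R : ℝ} (hR : 0 < R)
    (hg : DifferentiableOn ℂ g (Metric.ball 0 R)) (hne : ∀ z ∈ Metric.ball (0 : ℂ) R, g z ≠ 0) :
    ∃ L : ℂ → ℂ, L 0 = 0 ∧ (∀ z ∈ Metric.ball (0 : ℂ) R, HasDerivAt L (logDeriv g z) z) ∧
      ∀ z ∈ Metric.ball (0 : ℂ) R, g z = g 0 * exp (L z) := by
  have hd : DifferentiableOn ℂ (logDeriv g) (Metric.ball 0 R) :=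
    (hg.deriv Metric.isOpen_ball).div hg hne
  obtain ⟨L, hL0, hL⟩ := hd.isExactOn_ball.with_val_at 0 0
  refine ⟨L, hL0, hL, ?_⟩
  have key : ∀ z ∈ Metric.ball (0 : ℂ) R, HasDerivAt (fun z => g z * exp (-L z)) 0 z := by
    intro z hz
    have h1 : HasDerivAt g (deriv g z) z :=
      (hg.differentiableAt (Metric.isOpen_ball.mem_nhds hz)).hasDerivAt
    refine (h1.mul (hL z hz).neg.cexp).congr_deriv ?_
    have := hne z hz
    rw [logDeriv_apply]
    field_simp
    ring
  have hconst : ∀ z ∈ Metric.ball (0 : ℂ) R, g z * exp (-L z) = g 0 * exp (-L 0) := by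
    intro z hz
    refine Metric.isOpen_ball.is_const_of_deriv_eq_zero (𝕜 := ℂ) (f := fun z => g z * exp (-L z))
      (convex_ball 0 R).isPreconnected
      (fun w hw => (key w hw).differentiableAt.differentiableWithinAt)
      (fun w hw => (key w hw).deriv) hz (Metric.mem_ball_self hR)
  intro z hz
  have := hconst z hz
  rw [hL0, neg_zero, exp_zero, mul_one] at this
  rw [← this, mul_assoc, ← exp_add, neg_add_cancel, exp_zero, mul_one]

/-- The logarithm of $g/g(0)$ has real part at most $A$, so Borel–Carathéodory bounds it and
Cauchy's estimate bounds its second derivative. The decay $A/R^2$ is the point: with $A=O(R^{3/2})$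
the logarithmic derivative becomes constant as $R\to\infty$. -/
theorem norm_logDeriv_sub_le {g : ℂ → ℂ} {R A : ℝ} (hR : 0 < R) (hA : 0 < A)
    (hg : DifferentiableOn ℂ g (Metric.ball 0 R)) (hne : ∀ z ∈ Metric.ball (0 : ℂ) R, g z ≠ 0)
    (hM : ∀ z ∈ Metric.ball (0 : ℂ) R, ‖g z‖ ≤ ‖g 0‖ * Real.exp A) {z : ℂ} (hz : ‖z‖ ≤ R / 4) :
    ‖logDeriv g z - logDeriv g 0‖ ≤ 96 * A / R ^ 2 * ‖z‖ := by
  obtain ⟨L, hL0, hL, hgL⟩ := exists_log_ball hR hg hne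
  have hLd : DifferentiableOn ℂ L (Metric.ball 0 R) := fun z hz =>
    (hL z hz).differentiableAt.differentiableWithinAt
  have h0 : g 0 ≠ 0 := hne 0 (Metric.mem_ball_self hR)
  have hre : Set.MapsTo L (Metric.ball 0 R) {z | z.re ≤ A} := by
    intro w hw
    have h1 := hM w hw
    rw [hgL w hw, norm_mul, norm_exp] at h1
    exact Real.exp_le_exp.1 (le_of_mul_le_mul_left h1 (norm_pos_iff.2 h0))
  -- At radius $3R/4$ the Borel–Carathéodory factor $2|w|/(R-|w|)$ equals $6$. Two Cauchy estimates
  -- on circles of radius $R/4$ then cost a factor $4/R$ each, giving $24A/R$ and $96A/R^2$.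
  have b1 : ∀ w : ℂ, ‖w‖ ≤ 3 * R / 4 → ‖L w‖ ≤ 6 * A := by
    intro w hw
    have hwR : w ∈ Metric.ball (0 : ℂ) R := by simp; linarith
    refine (borelCaratheodory_zero hA hLd hre hR hwR hL0).trans ?_
    rw [div_le_iff₀ (by linarith)]
    nlinarith
  have b2 : ∀ w : ℂ, ‖w‖ ≤ R / 2 → ‖deriv L w‖ ≤ 24 * A / R := by
    intro w hw
    have hsub : Metric.closedBall w (R / 4) ⊆ Metric.ball 0 R := by
      intro v hv
      simp only [Metric.mem_closedBall, dist_eq_norm, Metric.mem_ball, sub_zero] at hv ⊢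
      have := norm_le_norm_sub_add v w
      linarith
    have := norm_deriv_le_of_forall_mem_sphere_norm_le (f := L) (c := w) (C := 6 * A)
      (R := R / 4) (by positivity)
      (hLd.diffContOnCl_ball hsub) (fun v hv => b1 v (by
        simp only [mem_sphere_iff_norm] at hv
        have := norm_le_norm_sub_add v w
        linarith))
    refine this.trans (le_of_eq ?_)
    field_simp
    norm_num
  have hLd2 : DifferentiableOn ℂ (deriv L) (Metric.ball 0 R) := hLd.deriv Metric.isOpen_ball
  have b3 : ∀ w : ℂ, ‖w‖ ≤ R / 4 → ‖deriv (deriv L) w‖ ≤ 96 * A / R ^ 2 := by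
    intro w hw
    have hsub : Metric.closedBall w (R / 4) ⊆ Metric.ball 0 R := by
      intro v hv
      simp only [Metric.mem_closedBall, dist_eq_norm, Metric.mem_ball, sub_zero] at hv ⊢
      have := norm_le_norm_sub_add v w
      linarith
    have := norm_deriv_le_of_forall_mem_sphere_norm_le (f := deriv L) (c := w) (C := 24 * A / R)
      (R := R / 4) (by positivity)
      (hLd2.diffContOnCl_ball hsub) (fun v hv => b2 v (by
        simp only [mem_sphere_iff_norm] at hv
        have := norm_le_norm_sub_add v w
        linarith))
    refine this.trans (le_of_eq ?_)
    field_simp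
    norm_num
  have hin : ∀ w : ℂ, ‖w‖ ≤ R / 4 → w ∈ Metric.ball (0 : ℂ) R := by
    intro w hw; simp; linarith
  have := Convex.norm_image_sub_le_of_norm_deriv_le (𝕜 := ℂ) (f := deriv L)
    (s := Metric.closedBall (0 : ℂ) (R / 4)) (C := 96 * A / R ^ 2) (x := 0) (y := z)
    (fun w hw => hLd2.differentiableAt
      (Metric.isOpen_ball.mem_nhds (hin w (by simpa using hw))))
    (fun w hw => b3 w (by simpa using hw)) (convex_closedBall _ _)
    (by simp; positivity) (by simpa using hz)
  rw [(hL z (hin z hz)).deriv, (hL 0 (hin 0 (by simp; positivity))).deriv, sub_zero] at this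
  exact this

/-- Identity theorem. It guards every use of `analyticOrderNatAt`, whose value at infinite order is
the default $0$. -/
theorem analyticOrderAt_ne_top_of_entire {f : ℂ → ℂ} (hf : Differentiable ℂ f)
    (h : ∃ z, f z ≠ 0) (ρ : ℂ) : analyticOrderAt f ρ ≠ ⊤ := by
  intro htop
  obtain ⟨z, hz⟩ := h
  have h1 : f =ᶠ[𝓝 ρ] 0 := analyticOrderAt_eq_top.1 htop
  have h2 : AnalyticOnNhd ℂ f Set.univ := fun z _ => hf.analyticAt z
  have := h2.eq_of_eventuallyEq (g := 0) (fun z _ => analyticAt_const) h1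
  exact hz (congrFun this z)

theorem exists_eq_pow_order_mul {f : ℂ → ℂ} (hf : Differentiable ℂ f)
    (h : ∃ z, f z ≠ 0) (ρ : ℂ) : ∃ g : ℂ → ℂ, Differentiable ℂ g ∧ g ρ ≠ 0 ∧
      ∀ z, f z = (z - ρ) ^ analyticOrderNatAt f ρ * g z := by
  obtain ⟨h1, ha, hρ, he⟩ := ((hf.analyticAt ρ).analyticOrderAt_ne_top).1
    (analyticOrderAt_ne_top_of_entire hf h ρ)
  set k := analyticOrderNatAt f ρ
  let g : ℂ → ℂ := fun z => if z = ρ then h1 ρ else f z / (z - ρ) ^ k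
  have hgρ : g =ᶠ[𝓝 ρ] h1 := by
    filter_upwards [he] with z hz
    by_cases hzρ : z = ρ
    · simp [g, hzρ]
    · have : (z - ρ) ^ k ≠ 0 := pow_ne_zero _ (sub_ne_zero.2 hzρ)
      simp only [g, hzρ, if_false, hz, smul_eq_mul]
      field_simp
  refine ⟨g, ?_, by simpa [g] using hρ, ?_⟩
  · intro z
    by_cases hzρ : z = ρ
    · subst hzρ
      exact hgρ.differentiableAt_iff.2 ha.differentiableAt
    · have : g =ᶠ[𝓝 z] fun z => f z / (z - ρ) ^ k := by
        filter_upwards [isOpen_ne.mem_nhds hzρ] with w hw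
        simp only [g, show w ≠ ρ from hw, if_false]
      refine this.differentiableAt_iff.2 ?_
      exact (hf z).div (by fun_prop) (pow_ne_zero _ (sub_ne_zero.2 hzρ))
  · intro z
    by_cases hzρ : z = ρ
    · subst hzρ
      simpa [g] using he.self_of_nhds
    · have : (z - ρ) ^ k ≠ 0 := pow_ne_zero _ (sub_ne_zero.2 hzρ)
      simp only [g, hzρ, if_false]
      field_simp

/-- Induction on $S$: the factors already removed do not vanish at the new point, so the order of
$f$ there is still that of the cofactor. -/
theorem exists_eq_prod_mul {f : ℂ → ℂ} (hf : Differentiable ℂ f) (h : ∃ z, f z ≠ 0)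
    (S : Finset ℂ) (hS : (0 : ℂ) ∉ S) : ∃ g : ℂ → ℂ, Differentiable ℂ g ∧ (∀ ρ ∈ S, g ρ ≠ 0) ∧
      ∀ z, f z = (∏ ρ ∈ S, (1 - z / ρ) ^ analyticOrderNatAt f ρ) * g z := by
  induction S using Finset.induction_on with
  | empty => exact ⟨f, hf, by simp, by simp⟩
  | insert ρ S hρS ih =>
    obtain ⟨g, hg, hgS, hfg⟩ := ih (fun h => hS (Finset.mem_insert_of_mem h))
    have hρ0 : ρ ≠ 0 := fun h => hS (h ▸ Finset.mem_insert_self _ _)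
    have hg0 : ∃ z, g z ≠ 0 := by
      obtain ⟨z, hz⟩ := h
      exact ⟨z, fun h0 => hz (by rw [hfg, h0, mul_zero])⟩
    obtain ⟨k, hk, hkρ, hgk⟩ := exists_eq_pow_order_mul hg hg0 ρ
    let P : ℂ → ℂ := fun z => ∏ ρ ∈ S, (1 - z / ρ) ^ analyticOrderNatAt f ρ
    have hP : Differentiable ℂ P := by fun_prop
    have hPρ : P ρ ≠ 0 := by
      refine Finset.prod_ne_zero_iff.2 fun τ hτ => pow_ne_zero _ ?_
      have hτ0 : τ ≠ 0 := fun h => hS (h ▸ Finset.mem_insert_of_mem hτ)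
      rw [sub_ne_zero, ne_eq, eq_comm, div_eq_one_iff_eq hτ0]
      rintro rfl
      exact hρS hτ
    have hord : analyticOrderNatAt g ρ = analyticOrderNatAt f ρ := by
      have h1 : f = P * g := funext hfg
      have h2 : analyticOrderAt P ρ = 0 := analyticOrderAt_eq_zero.2 (Or.inr hPρ)
      rw [analyticOrderNatAt, analyticOrderNatAt, h1,
        analyticOrderAt_mul (hP.analyticAt ρ) (hg.analyticAt ρ), h2, zero_add]
    refine ⟨fun z => (-ρ) ^ analyticOrderNatAt f ρ * k z, by fun_prop, ?_, ?_⟩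
    · intro τ hτ
      refine mul_ne_zero (pow_ne_zero _ (neg_ne_zero.2 hρ0)) ?_
      rcases Finset.mem_insert.1 hτ with rfl | hτ
      · exact hkρ
      · intro h0
        exact hgS τ hτ (by rw [hgk, h0, mul_zero])
    · intro z
      rw [hfg z, hgk z, Finset.prod_insert hρS, hord]
      have : (z - ρ) ^ analyticOrderNatAt f ρ
          = (1 - z / ρ) ^ analyticOrderNatAt f ρ * (-ρ) ^ analyticOrderNatAt f ρ := by
        rw [← mul_pow]
        congr 1
        field_simp
        ring
      rw [this]
      ring

/-- Dividing out zeros in `‖ρ‖ ≤ R` keeps the growth on the disc of radius `4 R`, and the number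
of these zeros is bounded by the logarithm of the growth. -/
theorem bound_of_eq_prod_mul {f g : ℂ → ℂ} {R A : ℝ} (hR : 0 < R) (hf0 : f 0 ≠ 0)
    (hg : Differentiable ℂ g) (S : Finset ℂ) (hS0 : (0 : ℂ) ∉ S) (hS : ∀ ρ ∈ S, ‖ρ‖ ≤ R)
    (m : ℂ → ℕ) (hfg : ∀ z, f z = (∏ ρ ∈ S, (1 - z / ρ) ^ m ρ) * g z)
    (hA : ∀ z : ℂ, ‖z‖ = 4 * R → ‖f z‖ ≤ ‖f 0‖ * Real.exp A) :
    g 0 = f 0 ∧ (∀ z : ℂ, ‖z‖ ≤ 4 * R → ‖g z‖ ≤ ‖g 0‖ * Real.exp A) ∧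
      ∑ ρ ∈ S, (m ρ : ℝ) ≤ A := by
  have h0 : g 0 = f 0 := by rw [hfg 0]; simp
  -- On $|z|=4R$ every factor satisfies $|1-z/\rho|\ge 4-1=3$. The maximum principle carries the
  -- gain $3^{N}$ inside, and evaluation at $0$ together with $e\le3$ bounds the number $N$ of zeros
  -- by $A$.
  have hb : ∀ z : ℂ, ‖z‖ = 4 * R → 3 ^ (∑ ρ ∈ S, m ρ) * ‖g z‖ ≤ ‖f 0‖ * Real.exp A := by
    intro z hz
    refine le_trans ?_ (hA z hz)
    rw [hfg z, norm_mul, norm_prod]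
    gcongr
    rw [← Finset.prod_pow_eq_pow_sum]
    refine Finset.prod_le_prod (fun _ _ => by positivity) fun ρ hρ => ?_
    rw [norm_pow]
    gcongr
    have hρ0 : 0 < ‖ρ‖ := norm_pos_iff.2 fun h => hS0 (h ▸ hρ)
    have : 4 ≤ ‖z / ρ‖ := by
      rw [norm_div, hz, le_div_iff₀ hρ0]
      linarith [hS ρ hρ]
    have h2 := norm_sub_norm_le (z / ρ) 1
    rw [norm_one, norm_sub_rev] at h2
    linarith
  have key : ∀ z : ℂ, ‖z‖ ≤ 4 * R →
      ‖g z‖ ≤ ‖f 0‖ * Real.exp A / 3 ^ (∑ ρ ∈ S, m ρ) := by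
    intro z hz
    refine Complex.norm_le_of_forall_mem_frontier_norm_le (U := Metric.ball 0 (4 * R))
      Metric.isBounded_ball hg.diffContOnCl (fun w hw => ?_) ?_
    · rw [frontier_ball _ (by positivity)] at hw
      rw [le_div_iff₀ (by positivity), mul_comm]
      exact hb w (by simpa using hw)
    · rw [closure_ball _ (by positivity)]
      simpa using hz
  have h3 : (1 : ℝ) ≤ 3 ^ (∑ ρ ∈ S, m ρ) := one_le_pow₀ (by norm_num)
  have hf0' : 0 < ‖f 0‖ := norm_pos_iff.2 hf0
  refine ⟨h0, fun z hz => (key z hz).trans ?_, ?_⟩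
  · rw [h0]
    exact div_le_self (by positivity) h3
  · have := key 0 (by simp; positivity)
    rw [h0, le_div_iff₀ (by positivity)] at this
    have h4 := le_of_mul_le_mul_left this hf0'
    have h5 : Real.exp (∑ ρ ∈ S, (m ρ : ℝ)) ≤ 3 ^ (∑ ρ ∈ S, m ρ) := by
      rw [← Nat.cast_sum, ← mul_one ((_ : ℕ) : ℝ), Real.exp_nat_mul]
      gcongr
      linarith [Real.exp_one_lt_d9]
    exact Real.exp_le_exp.1 (h5.trans h4)

end SelbergScrew
end

/-! ### Partial fractions for entire functions of order below two. -/

noncomputable section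
namespace SelbergScrew

/-- `f` is entire, does not vanish at `0` and has growth of order at most `3/2`. -/
structure GenusOne (f : ℂ → ℂ) (B : ℝ) : Prop where
  diff : Differentiable ℂ f
  ne : f 0 ≠ 0
  pos : 0 < B
  le : ∀ z, ‖f z‖ ≤ ‖f 0‖ * Real.exp (B * (1 + ‖z‖) ^ (3 / 2 : ℝ))

namespace GenusOne

variable {f : ℂ → ℂ} {B : ℝ}

theorem sum_order_le (h : GenusOne f B) {R : ℝ} (hR : 0 < R) (S : Finset ℂ)
    (hS0 : (0 : ℂ) ∉ S) (hS : ∀ ρ ∈ S, ‖ρ‖ ≤ R) :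
    ∑ ρ ∈ S, (analyticOrderNatAt f ρ : ℝ) ≤ B * (1 + 4 * R) ^ (3 / 2 : ℝ) := by
  obtain ⟨g, hg, -, hfg⟩ := exists_eq_prod_mul h.diff ⟨0, h.ne⟩ S hS0
  exact (bound_of_eq_prod_mul hR h.ne hg S hS0 hS _ hfg (fun z hz => by
    rw [← hz]; exact h.le z)).2.2

/-- Dyadic shells: the shell of radius $\delta2^n$ carries $O(2^{3n/2})$ zeros, each of weight
$O(4^{-n})$, so the sum is dominated by a geometric series of ratio $2^{3/2}/4<1$. -/
theorem summable_order (h : GenusOne f B) :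
    Summable fun ρ : {ρ // f ρ = 0} => (analyticOrderNatAt f ρ : ℝ) / ‖(ρ : ℂ)‖ ^ 2 := by
  classical
  obtain ⟨δ, hδ, hball⟩ := Metric.mem_nhds_iff.1
    (h.diff.continuous.continuousAt.eventually_ne h.ne)
  have hex : ∀ ρ : {ρ // f ρ = 0}, ∃ n : ℕ, ‖(ρ : ℂ)‖ ≤ δ * 2 ^ n := by
    intro ρ
    obtain ⟨n, hn⟩ := pow_unbounded_of_one_lt (‖(ρ : ℂ)‖ / δ) (one_lt_two)
    exact ⟨n, by rw [div_lt_iff₀ hδ] at hn; linarith⟩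
  -- The shell index is the least admissible $n$, so $|\rho|\ge\delta2^n/2$ as well. For $n=0$ this
  -- lower bound comes from the zero-free disc of radius $\delta$.
  let k : {ρ // f ρ = 0} → ℕ := fun ρ => Nat.find (hex ρ)
  have hk1 : ∀ ρ : {ρ // f ρ = 0}, ‖(ρ : ℂ)‖ ≤ δ * 2 ^ k ρ := fun ρ => Nat.find_spec (hex ρ)
  have hk2 : ∀ ρ : {ρ // f ρ = 0}, δ * 2 ^ k ρ / 2 ≤ ‖(ρ : ℂ)‖ := by
    intro ρ
    rcases Nat.eq_zero_or_pos (k ρ) with h0 | h0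
    · rw [h0, pow_zero, mul_one]
      by_contra! hlt
      exact hball (show (ρ : ℂ) ∈ Metric.ball 0 δ by simp; linarith) ρ.2
    · have := Nat.find_min (hex ρ) (m := k ρ - 1) (Nat.sub_lt h0 one_pos)
      push Not at this
      have h2 : (2 : ℝ) ^ k ρ = 2 * 2 ^ (k ρ - 1) := by
        rw [← pow_succ', Nat.sub_add_cancel h0]
      rw [h2]
      linarith
  let c : ℝ := B * (1 + 4 * δ) ^ (3 / 2 : ℝ) * 4 / δ ^ 2
  let r : ℝ := 2 ^ (3 / 2 : ℝ) / 4
  have hr : r < 1 := by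
    have : (2 : ℝ) ^ (3 / 2 : ℝ) < 2 ^ (2 : ℝ) :=
      Real.rpow_lt_rpow_of_exponent_lt one_lt_two (by norm_num)
    rw [Real.rpow_two] at this
    simp only [r]
    linarith
  have hr0 : 0 ≤ r := by positivity
  have hB := h.pos
  have hsum : Summable fun n : ℕ => c * r ^ n :=
    (summable_geometric_of_lt_one hr0 hr).mul_left c
  refine summable_of_sum_le (c := ∑' n : ℕ, c * r ^ n) (fun _ => by positivity) fun s => ?_
  rw [← Finset.sum_fiberwise_of_maps_to (t := s.image k) (g := k)
    (fun ρ hρ => Finset.mem_image_of_mem _ hρ)]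
  refine (Finset.sum_le_sum fun n _ => ?_).trans
    (hsum.sum_le_tsum _ fun n _ => by positivity)
  have h1 : ∀ ρ ∈ s.filter (fun ρ => k ρ = n),
      (analyticOrderNatAt f ρ : ℝ) / ‖(ρ : ℂ)‖ ^ 2
        ≤ analyticOrderNatAt f ρ * (4 / (δ * 2 ^ n) ^ 2) := by
    intro ρ hρ
    have hkn := (Finset.mem_filter.1 hρ).2
    have h2 := hk2 ρ
    rw [hkn] at h2
    rw [div_eq_mul_inv]
    gcongr
    rw [inv_le_comm₀ (by have : 0 < δ * 2 ^ n / 2 := by positivity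
                         have := this.trans_le h2
                         positivity) (by positivity)]
    calc (4 / (δ * 2 ^ n) ^ 2)⁻¹ = (δ * 2 ^ n / 2) ^ 2 := by field_simp; norm_num
      _ ≤ _ := by gcongr
  refine (Finset.sum_le_sum h1).trans ?_
  rw [← Finset.sum_mul]
  have h3 := h.sum_order_le (R := δ * 2 ^ n) (by positivity)
    ((s.filter (fun ρ => k ρ = n)).map ⟨Subtype.val, Subtype.val_injective⟩)
    (by
      simp only [Finset.mem_map, not_exists, not_and]
      rintro ρ - h0
      exact h.ne ((congrArg f h0).symm.trans ρ.2))
    (by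
      simp only [Finset.mem_map, Finset.mem_filter]
      rintro _ ⟨ρ, ⟨-, rfl⟩, rfl⟩
      exact hk1 ρ)
  rw [Finset.sum_map] at h3
  refine (mul_le_mul_of_nonneg_right h3 (by positivity)).trans ?_
  have h4 : (1 + 4 * (δ * 2 ^ n)) ^ (3 / 2 : ℝ)
      ≤ (1 + 4 * δ) ^ (3 / 2 : ℝ) * (2 ^ (3 / 2 : ℝ)) ^ n := by
    rw [← Real.rpow_natCast (2 ^ (3 / 2 : ℝ)), ← Real.rpow_mul (by norm_num), mul_comm (3 / 2 : ℝ),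
      Real.rpow_mul (by norm_num), Real.rpow_natCast, ← Real.mul_rpow (by positivity) (by positivity)]
    gcongr
    have : (1 : ℝ) ≤ 2 ^ n := one_le_pow₀ one_le_two
    nlinarith
  calc B * (1 + 4 * (δ * 2 ^ n)) ^ (3 / 2 : ℝ) * (4 / (δ * 2 ^ n) ^ 2)
      ≤ B * ((1 + 4 * δ) ^ (3 / 2 : ℝ) * (2 ^ (3 / 2 : ℝ)) ^ n) * (4 / (δ * 2 ^ n) ^ 2) := by
        gcongr
    _ = c * r ^ n := by
        simp only [c, r]
        rw [div_pow, mul_pow, ← pow_mul, mul_comm n 2, pow_mul]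
        field_simp
        norm_num

theorem one_le_order (h : GenusOne f B) {ρ : ℂ} (hρ : f ρ = 0) : 1 ≤ analyticOrderNatAt f ρ := by
  rw [Nat.one_le_iff_ne_zero]
  intro h0
  have h1 := Nat.cast_analyticOrderNatAt (analyticOrderAt_ne_top_of_entire h.diff ⟨0, h.ne⟩ ρ)
  rw [h0, Nat.cast_zero, eq_comm, analyticOrderAt_eq_zero] at h1
  exact h1.elim (fun h2 => h2 (h.diff.analyticAt ρ)) (fun h2 => h2 hρ)

theorem zero_ne (h : GenusOne f B) (ρ : {ρ // f ρ = 0}) : (ρ : ℂ) ≠ 0 := fun h0 =>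
  h.ne ((congrArg f h0).symm.trans ρ.2)

theorem finite_zeros (h : GenusOne f B) (N : ℝ) :
    {ρ : {ρ // f ρ = 0} | ‖(ρ : ℂ)‖ ≤ N}.Finite := by
  have h1 := h.summable_order.tendsto_cofinite_zero.eventually
    (gt_mem_nhds (show 0 < 1 / (1 + N ^ 2) by positivity))
  rw [eventually_cofinite] at h1
  refine h1.subset fun ρ hρ => ?_
  have hρ' : ‖(ρ : ℂ)‖ ≤ N := hρ
  have hpos : 0 < ‖(ρ : ℂ)‖ := norm_pos_iff.2 (h.zero_ne ρ)
  have h2 : (1 : ℝ) ≤ analyticOrderNatAt f ρ := by exact_mod_cast h.one_le_order ρ.2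
  simp only [Set.mem_ofPred_eq, not_lt]
  gcongr
  nlinarith

theorem norm_term_le {z ρ : ℂ} {c : ℝ} (hc : 0 < c) (hρ0 : ρ ≠ 0) (hc' : c * ‖ρ‖ ≤ ‖z - ρ‖) :
    ‖1 / (z - ρ) + 1 / ρ‖ ≤ ‖z‖ / c / ‖ρ‖ ^ 2 := by
  have hpos : 0 < ‖ρ‖ := norm_pos_iff.2 hρ0
  have hne : z - ρ ≠ 0 := norm_pos_iff.1 (lt_of_lt_of_le (by positivity) hc')
  have : 1 / (z - ρ) + 1 / ρ = z / ((z - ρ) * ρ) := by field_simp; ring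
  rw [this, norm_div, norm_mul, div_div]
  refine div_le_div_of_nonneg_left (norm_nonneg z) (by positivity) ?_
  nlinarith

theorem summable_term (h : GenusOne f B) (z : ℂ) :
    Summable fun ρ : {ρ // f ρ = 0} =>
      (analyticOrderNatAt f ρ : ℂ) * (1 / (z - ρ) + 1 / ρ) := by
  refine Summable.of_norm_bounded_eventually (h.summable_order.mul_left (‖z‖ / (1 / 2))) ?_
  rw [eventually_cofinite]
  refine (h.finite_zeros (2 * ‖z‖)).subset fun ρ hρ => ?_
  by_contra hlt
  simp only [Set.mem_ofPred_eq, not_le] at hlt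
  refine hρ ?_
  have := norm_term_le (z := z) (ρ := ρ) (c := 1 / 2) (by norm_num) (h.zero_ne ρ) (by
    have := norm_sub_norm_le (ρ : ℂ) z
    rw [norm_sub_rev] at this
    linarith)
  rw [norm_mul, norm_natCast]
  refine (mul_le_mul_of_nonneg_left this (by positivity)).trans (le_of_eq ?_)
  ring

theorem logDeriv_prod_mul {g : ℂ → ℂ} (S : Finset ℂ) (m : ℂ → ℕ) (hg : Differentiable ℂ g)
    (hfg : ∀ z, f z = (∏ ρ ∈ S, (1 - z / ρ) ^ m ρ) * g z)
    (hS0 : (0 : ℂ) ∉ S) {z : ℂ} (hzS : z ∉ S) (hgz : g z ≠ 0) :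
    logDeriv f z = ∑ ρ ∈ S, (m ρ : ℂ) * (1 / (z - ρ)) + logDeriv g z := by
  have hf : f = fun z => (∏ ρ ∈ S, (1 - z / ρ) ^ m ρ) * g z := funext hfg
  have hne : ∀ ρ ∈ S, (1 - z / ρ) ≠ 0 := by
    intro ρ hρ
    have hρ0 : ρ ≠ 0 := fun h => hS0 (h ▸ hρ)
    rw [sub_ne_zero, ne_eq, eq_comm, div_eq_one_iff_eq hρ0]
    rintro rfl
    exact hzS hρ
  rw [hf, logDeriv_mul (f := fun z => ∏ ρ ∈ S, (1 - z / ρ) ^ m ρ) (g := g) z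
    (Finset.prod_ne_zero_iff.2 fun ρ hρ => pow_ne_zero _ (hne ρ hρ)) hgz (by fun_prop) (hg z)]
  congr 1
  rw [logDeriv_prod (f := fun ρ z => (1 - z / ρ) ^ m ρ)
    (fun ρ hρ => pow_ne_zero _ (hne ρ hρ)) (fun ρ _ => by fun_prop)]
  refine Finset.sum_congr rfl fun ρ hρ => ?_
  have hρ0 : ρ ≠ 0 := fun h => hS0 (h ▸ hρ)
  rw [logDeriv_fun_pow (f := fun z => 1 - z / ρ) (by fun_prop)]
  congr 1
  rw [logDeriv_apply]
  have : deriv (fun z : ℂ => 1 - z / ρ) z = -(1 / ρ) := by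
    simp
  rw [this]
  have h1 := hne ρ hρ
  have h2 : z - ρ ≠ 0 := by
    rw [sub_ne_zero]; rintro rfl; exact hzS hρ
  have h3 : 1 - z / ρ = -((z - ρ) / ρ) := by field_simp; ring
  rw [h3]
  field_simp

/-- The partial fraction expansion of the logarithmic derivative of an entire function of order
less than two. -/
theorem hasSum_logDeriv (h : GenusOne f B) {z : ℂ} (hz : f z ≠ 0) :
    HasSum (fun ρ : {ρ // f ρ = 0} => (analyticOrderNatAt f ρ : ℂ) * (1 / (z - ρ) + 1 / ρ))
      (logDeriv f z - logDeriv f 0) := by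
  classical
  have hs := (h.summable_term z).hasSum
  let T : ℕ → Finset {ρ // f ρ = 0} := fun N => (h.finite_zeros N).toFinset
  have hT : Tendsto T atTop atTop := by
    refine tendsto_atTop_finset_of_monotone (fun M N hMN ρ hρ => ?_) fun ρ => ?_
    · simp only [T, Set.Finite.mem_toFinset, Set.mem_ofPred_eq] at hρ ⊢
      exact hρ.trans (by exact_mod_cast hMN)
    · obtain ⟨N, hN⟩ := exists_nat_ge ‖(ρ : ℂ)‖
      exact ⟨N, by simpa [T] using hN⟩
  have hlim := hs.comp hT
  -- After division by the zeros with $|\rho|\le N$ the cofactor has no zeros in the disc of radius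
  -- $N$ and obeys the growth bound of $f$, so its logarithmic derivative varies by only
  -- $O(N^{3/2}/N^2)$ between $0$ and $z$. The terms $1/\rho$ arise from subtracting the value at
  -- $0$.
  have key : ∀ N : ℕ, 0 < N → 4 * ‖z‖ ≤ N →
      ‖(logDeriv f z - logDeriv f 0) -
        ∑ ρ ∈ T N, (analyticOrderNatAt f ρ : ℂ) * (1 / (z - ρ) + 1 / ρ)‖
      ≤ 96 * (B * (1 + 4 * (N : ℝ)) ^ (3 / 2 : ℝ)) / (N : ℝ) ^ 2 * ‖z‖ := by
    intro N hN hzN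
    have hN0 : (0 : ℝ) < N := by exact_mod_cast hN
    let S : Finset ℂ := (T N).map ⟨Subtype.val, Subtype.val_injective⟩
    have hSmem : ∀ ρ, ρ ∈ S ↔ f ρ = 0 ∧ ‖ρ‖ ≤ N := by
      intro ρ
      simp [S, T, and_comm]
    have hS0 : (0 : ℂ) ∉ S := fun h0 => h.ne ((hSmem 0).1 h0).1
    have hzS : z ∉ S := fun h0 => hz ((hSmem z).1 h0).1
    obtain ⟨g, hg, hgS, hfg⟩ := exists_eq_prod_mul h.diff ⟨0, h.ne⟩ S hS0
    obtain ⟨hg0, hgA, -⟩ := bound_of_eq_prod_mul hN0 h.ne hg S hS0 (fun ρ hρ => ((hSmem ρ).1 hρ).2)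
      _ hfg (A := B * (1 + 4 * (N : ℝ)) ^ (3 / 2 : ℝ)) (fun z hz => by rw [← hz]; exact h.le z)
    have hgne : ∀ w ∈ Metric.ball (0 : ℂ) N, g w ≠ 0 := by
      intro w hw h0
      have hfw : f w = 0 := by rw [hfg, h0, mul_zero]
      exact hgS w ((hSmem w).2 ⟨hfw, by simpa using (Metric.mem_ball.1 hw).le⟩) h0
    have hA : 0 < B * (1 + 4 * (N : ℝ)) ^ (3 / 2 : ℝ) := by
      have := h.pos
      positivity
    have hb := norm_logDeriv_sub_le hN0 hA hg.differentiableOn hgne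
      (fun w hw => hgA w (by
        have : ‖w‖ < N := by simpa using hw
        linarith)) (z := z) (by linarith)
    refine le_trans (le_of_eq ?_) hb
    rw [logDeriv_prod_mul S _ hg hfg hS0 hzS (fun h0 => hz (by rw [hfg, h0, mul_zero])),
      logDeriv_prod_mul S _ hg hfg hS0 hS0 (by rw [hg0]; exact h.ne)]
    have : ∑ ρ ∈ T N, (analyticOrderNatAt f ρ : ℂ) * (1 / (z - ρ) + 1 / ρ)
        = ∑ ρ ∈ S, (analyticOrderNatAt f ρ : ℂ) * (1 / (z - ρ) + 1 / ρ) := by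
      simp [S, Finset.sum_map]
    rw [this]
    congr 1
    simp only [mul_add, Finset.sum_add_distrib, zero_sub, one_div, inv_neg, mul_neg,
      Finset.sum_neg_distrib]
    ring
  have herr : Tendsto (fun N : ℕ => 96 * (B * (1 + 4 * (N : ℝ)) ^ (3 / 2 : ℝ)) / (N : ℝ) ^ 2 * ‖z‖)
      atTop (𝓝 0) := by
    have h1 : Tendsto (fun N : ℕ => 96 * B * 5 ^ (3 / 2 : ℝ) * ‖z‖ * (N : ℝ) ^ (-(1 / 2) : ℝ))
        atTop (𝓝 0) := by
      rw [← mul_zero (96 * B * 5 ^ (3 / 2 : ℝ) * ‖z‖)]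
      exact ((tendsto_rpow_neg_atTop (by norm_num)).comp tendsto_natCast_atTop_atTop).const_mul _
    have hB := h.pos
    refine squeeze_zero' (Eventually.of_forall fun N => by positivity) ?_ h1
    filter_upwards [eventually_ge_atTop 1] with N hN
    have hN0 : (1 : ℝ) ≤ N := by exact_mod_cast hN
    have h2 : (1 + 4 * (N : ℝ)) ^ (3 / 2 : ℝ) ≤ 5 ^ (3 / 2 : ℝ) * (N : ℝ) ^ (3 / 2 : ℝ) := by
      rw [← Real.mul_rpow (by norm_num) (by positivity)]
      gcongr
      linarith
    have h3 : (N : ℝ) ^ (3 / 2 : ℝ) / (N : ℝ) ^ 2 = (N : ℝ) ^ (-(1 / 2) : ℝ) := by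
      rw [← Real.rpow_natCast, ← Real.rpow_sub (by positivity)]
      norm_num
    calc _ ≤ 96 * (B * (5 ^ (3 / 2 : ℝ) * (N : ℝ) ^ (3 / 2 : ℝ))) / (N : ℝ) ^ 2 * ‖z‖ := by gcongr
      _ = 96 * B * 5 ^ (3 / 2 : ℝ) * ‖z‖ * ((N : ℝ) ^ (3 / 2 : ℝ) / (N : ℝ) ^ 2) := by ring
      _ = _ := by rw [h3]
  have hlim2 : Tendsto (fun N => ∑ ρ ∈ T N, (analyticOrderNatAt f ρ : ℂ) * (1 / (z - ρ) + 1 / ρ))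
      atTop (𝓝 (logDeriv f z - logDeriv f 0)) := by
    rw [tendsto_iff_norm_sub_tendsto_zero]
    refine squeeze_zero' (Eventually.of_forall fun N => norm_nonneg _) ?_ herr
    obtain ⟨M, hM⟩ := exists_nat_ge (4 * ‖z‖)
    filter_upwards [eventually_ge_atTop M, eventually_gt_atTop 0] with N hN hN0
    rw [norm_sub_rev]
    exact key N hN0 (hM.trans (by exact_mod_cast hN))
  rwa [tendsto_nhds_unique hlim hlim2] at hs

end GenusOne

end SelbergScrew
end

/-! ### The gamma and digamma functions on the right half-plane. -/

noncomputable section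
namespace SelbergScrew

/-- Cauchy's integral formula for the derivative and dominated convergence: pointwise convergence
with a uniform bound on one circle is enough, and locally uniform convergence is not needed. -/
theorem tendsto_deriv_of_bounded {f : ℕ → ℂ → ℂ} {g : ℂ → ℂ} {U : Set ℂ} (hU : IsOpen U) {z : ℂ}
    {r M : ℝ} (hr : 0 < r) (hzr : Metric.closedBall z r ⊆ U)
    (hf : ∀ᶠ n in atTop, DifferentiableOn ℂ (f n) U) (hg : DifferentiableOn ℂ g U)
    (hM : ∀ᶠ n in atTop, ∀ w ∈ Metric.sphere z r, ‖f n w‖ ≤ M)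
    (hlim : ∀ w ∈ Metric.sphere z r, Tendsto (fun n => f n w) atTop (𝓝 (g w))) :
    Tendsto (fun n => deriv (f n) z) atTop (𝓝 (deriv g z)) := by
  have h1 : ∀ᶠ n in atTop, cderiv r (f n) z = deriv (f n) z := by
    filter_upwards [hf] with n hn using cderiv_eq_deriv hU hn hr hzr
  rw [← cderiv_eq_deriv hU hg hr hzr]
  refine Tendsto.congr' h1 ?_
  unfold cderiv circleIntegral
  have hsph : ∀ θ : ℝ, circleMap z r θ ∈ Metric.sphere z r := fun θ =>
    circleMap_mem_sphere z hr.le θ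
  have hcirc : Continuous (circleMap z r) := continuous_circleMap z r
  have hne : ∀ θ : ℝ, (circleMap z r θ - z) ^ 2 ≠ 0 := fun θ =>
    pow_ne_zero _ (sub_ne_zero.2 (circleMap_ne_center hr.ne'))
  refine (intervalIntegral.tendsto_integral_filter_of_dominated_convergence
    (fun _ => r * ((r ^ 2)⁻¹ * M)) ?_ ?_ (by simp) ?_).const_smul _
  · filter_upwards [hf] with n hn
    refine Continuous.aestronglyMeasurable ?_
    have h2 : Continuous fun θ => f n (circleMap z r θ) :=
      hn.continuousOn.comp_continuous hcirc fun θ =>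
        hzr (Metric.sphere_subset_closedBall (hsph θ))
    have h3 : Continuous fun θ => ((circleMap z r θ - z) ^ 2)⁻¹ :=
      Continuous.inv₀ (by fun_prop) hne
    have h4 : Continuous fun θ => deriv (circleMap z r) θ := by
      simp only [deriv_circleMap]
      fun_prop
    exact h4.smul (h3.smul h2)
  · filter_upwards [hM] with n hn
    refine Eventually.of_forall fun θ _ => ?_
    simp only [norm_smul, deriv_circleMap, norm_mul, norm_circleMap_zero, norm_I, mul_one, norm_inv,
      norm_pow, circleMap_sub_center, abs_of_pos hr]
    gcongr
    exact hn _ (hsph θ)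
  · refine Eventually.of_forall fun θ _ => ?_
    exact ((hlim _ (hsph θ)).const_smul _).const_smul _

theorem norm_Gamma_le {s : ℂ} (hs : 0 < s.re) : ‖Gamma s‖ ≤ Real.Gamma s.re := by
  rw [Gamma_eq_integral hs, Real.Gamma_eq_integral hs]
  refine MeasureTheory.norm_integral_le_of_norm_le (Real.GammaIntegral_convergent hs) ?_
  refine (MeasureTheory.ae_restrict_iff' measurableSet_Ioi).2 (Eventually.of_forall fun x hx => ?_)
  rw [norm_mul, norm_cpow_eq_rpow_re_of_pos hx, sub_re, one_re, norm_real, Real.norm_eq_abs,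
    abs_of_pos (Real.exp_pos _)]

/-- Compare the approximating integrals with Euler's integral through $(1-x/n)^n\le e^{-x}$. This is
the uniform bound required to differentiate Gauss's limit formula. -/
theorem norm_GammaSeq_le {s : ℂ} (hs : 0 < s.re) {n : ℕ} (hn : n ≠ 0) :
    ‖GammaSeq s n‖ ≤ Real.Gamma s.re := by
  rw [GammaSeq_eq_approx_Gamma_integral hs hn, Real.Gamma_eq_integral hs,
    intervalIntegral.integral_of_le (by positivity)]
  have hsub : Set.Ioc (0 : ℝ) n ⊆ Set.Ioi 0 := fun x hx => hx.1
  have hint := Real.GammaIntegral_convergent hs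
  refine (MeasureTheory.norm_integral_le_of_norm_le (hint.mono_set hsub) ?_).trans
    (MeasureTheory.setIntegral_mono_set hint ?_ (Eventually.of_forall hsub))
  · refine (MeasureTheory.ae_restrict_iff' measurableSet_Ioc).2
      (Eventually.of_forall fun x hx => ?_)
    have h1 : 0 ≤ 1 - x / n := sub_nonneg.2 (div_le_one_of_le₀ hx.2 (by positivity))
    rw [norm_mul, norm_cpow_eq_rpow_re_of_pos hx.1, sub_re, one_re, norm_real, Real.norm_eq_abs,
      abs_of_nonneg (pow_nonneg h1 n)]
    have := hx.1
    gcongr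
    exact Real.one_sub_div_pow_le_exp_neg hx.2
  · refine (MeasureTheory.ae_restrict_iff' measurableSet_Ioi).2
      (Eventually.of_forall fun x hx => ?_)
    have : (0 : ℝ) < x := hx
    positivity

theorem add_re_le_norm (a : ℂ) (n : ℕ) : n + a.re ≤ ‖(n : ℂ) + a‖ := by
  simpa using re_le_norm ((n : ℂ) + a)

theorem natCast_add_ne_zero {a : ℂ} (ha : 0 < a.re) (n : ℕ) : (n : ℂ) + a ≠ 0 := by
  refine norm_pos_iff.1 (lt_of_lt_of_le ?_ (add_re_le_norm a n))
  positivity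

theorem summable_inv_sq {δ : ℝ} (hδ : 0 < δ) : Summable fun n : ℕ => 1 / ((n : ℝ) + δ) ^ 2 := by
  have := (Real.summable_one_div_nat_add_rpow δ 2).2 one_lt_two
  refine this.congr fun n => ?_
  rw [abs_of_pos (by positivity), Real.rpow_two]

theorem summable_inv_norm_sq {a : ℂ} (ha : 0 < a.re) :
    Summable fun n : ℕ => 1 / ‖(n : ℂ) + a‖ ^ 2 := by
  refine (summable_inv_sq ha).of_nonneg_of_le (fun n => by positivity) fun n => ?_
  have := add_re_le_norm a n
  gcongr

theorem summable_inv_sub_inv {a z : ℂ} (ha : 0 < a.re) (hz : 0 < z.re) :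
    Summable fun n : ℕ => 1 / ((n : ℂ) + a) - 1 / ((n : ℂ) + z) := by
  have hδ : 0 < min a.re z.re := lt_min ha hz
  refine ((summable_inv_sq hδ).mul_left ‖z - a‖).of_norm_bounded fun n => ?_
  have h1 := natCast_add_ne_zero ha n
  have h2 := natCast_add_ne_zero hz n
  have h3 : 1 / ((n : ℂ) + a) - 1 / ((n : ℂ) + z) = (z - a) / (((n : ℂ) + a) * ((n : ℂ) + z)) := by
    field_simp
    ring
  rw [h3, norm_div, norm_mul, mul_one_div, sq]
  gcongr
  · exact le_trans (by gcongr; exact min_le_left _ _) (add_re_le_norm a n)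
  · exact le_trans (by gcongr; exact min_le_right _ _) (add_re_le_norm z n)

theorem differentiableAt_Gamma_of_re_pos {s : ℂ} (hs : 0 < s.re) : DifferentiableAt ℂ Gamma s := by
  refine differentiableAt_Gamma s fun m h => ?_
  rw [h] at hs
  simp at hs
  linarith [(Nat.cast_nonneg m : (0 : ℝ) ≤ m)]

theorem isOpen_re_pos : IsOpen {s : ℂ | 0 < s.re} := isOpen_lt continuous_const continuous_re

theorem logDeriv_GammaSeq {s : ℂ} (hs : 0 < s.re) {n : ℕ} (hn : n ≠ 0) :
    DifferentiableAt ℂ (fun s => GammaSeq s n) s ∧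
    logDeriv (fun s => GammaSeq s n) s
      = log n - ∑ j ∈ Finset.range (n + 1), 1 / ((j : ℂ) + s) := by
  have hn' : (n : ℂ) ≠ 0 := Nat.cast_ne_zero.2 hn
  have hfac : ((n.factorial : ℕ) : ℂ) ≠ 0 := Nat.cast_ne_zero.2 (Nat.factorial_ne_zero n)
  have hne : ∀ j ∈ Finset.range (n + 1), s + j ≠ 0 := fun j _ => by
    rw [add_comm]; exact natCast_add_ne_zero hs j
  have hprod : ∏ j ∈ Finset.range (n + 1), (s + j) ≠ 0 := Finset.prod_ne_zero_iff.2 hne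
  have hpow : HasDerivAt (fun s : ℂ => (n : ℂ) ^ s) ((n : ℂ) ^ s * log n) s := by
    simpa using (hasDerivAt_id s).const_cpow (c := (n : ℂ)) (Or.inl hn')
  have hpow0 : (n : ℂ) ^ s ≠ 0 := by simp [cpow_eq_zero_iff, hn']
  have hnum : DifferentiableAt ℂ (fun s : ℂ => (n : ℂ) ^ s * n.factorial) s :=
    hpow.differentiableAt.mul_const _
  refine ⟨?_, ?_⟩
  · unfold GammaSeq
    exact hnum.div (by fun_prop) hprod
  · unfold GammaSeq
    rw [logDeriv_div (f := fun s : ℂ => (n : ℂ) ^ s * n.factorial)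
      (g := fun s : ℂ => ∏ j ∈ Finset.range (n + 1), (s + j)) s (mul_ne_zero hpow0 hfac) hprod
      hnum (by fun_prop), logDeriv_prod (f := fun (j : ℕ) (s : ℂ) => s + j) hne
      (fun j _ => by fun_prop)]
    congr 1
    · rw [logDeriv_apply, (hpow.mul_const _).deriv]
      field_simp
    · refine Finset.sum_congr rfl fun j hj => ?_
      rw [logDeriv_apply]
      simp [add_comm]

/-- The logarithmic derivative of Gauss's limit formula for $\Gamma$, passed to the limit on a
circle of radius $\Re s/2$, which stays in the right half-plane. -/
theorem tendsto_digamma {s : ℂ} (hs : 0 < s.re) :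
    Tendsto (fun n : ℕ => log n - ∑ j ∈ Finset.range (n + 1), 1 / ((j : ℂ) + s)) atTop
      (𝓝 (digamma s)) := by
  obtain ⟨M, hM⟩ := (isCompact_Icc (a := s.re / 2) (b := 3 * s.re / 2)).exists_bound_of_continuousOn
    (f := Real.Gamma) (fun x hx => (Real.differentiableAt_Gamma fun m h => by
      have h1 := hx.1
      rw [h] at h1
      linarith [(Nat.cast_nonneg m : (0 : ℝ) ≤ m)]).continuousAt.continuousWithinAt)
  have hre : ∀ w : ℂ, ‖w - s‖ ≤ s.re / 2 → w.re ∈ Set.Icc (s.re / 2) (3 * s.re / 2) := by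
    intro w hw
    have h1 := (abs_le.1 ((abs_re_le_norm (w - s)).trans hw))
    simp only [sub_re] at h1
    exact ⟨by linarith [h1.1], by linarith [h1.2]⟩
  have hderiv := tendsto_deriv_of_bounded (f := fun n s => GammaSeq s n) (g := Gamma)
    isOpen_re_pos (z := s) (r := s.re / 2) (M := M) (by positivity)
    (fun w hw => by
      rw [Metric.mem_closedBall, dist_eq_norm] at hw
      have := (hre w hw).1
      show 0 < w.re
      linarith)
    (by
      filter_upwards [eventually_ne_atTop 0] with n hn
      exact fun w hw => (logDeriv_GammaSeq hw hn).1.differentiableWithinAt)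
    (fun w hw => (differentiableAt_Gamma_of_re_pos hw).differentiableWithinAt)
    (by
      filter_upwards [eventually_ne_atTop 0] with n hn w hw
      rw [mem_sphere_iff_norm] at hw
      have h1 := hre w hw.le
      refine (norm_GammaSeq_le (by linarith [h1.1]) hn).trans ((le_abs_self _).trans (hM _ h1)))
    (fun w _ => GammaSeq_tendsto_Gamma w)
  have := hderiv.div (GammaSeq_tendsto_Gamma s) (Gamma_ne_zero_of_re_pos hs)
  rw [digamma_def, logDeriv_apply]
  refine this.congr' ?_
  filter_upwards [eventually_ne_atTop 0] with n hn
  rw [← (logDeriv_GammaSeq hs hn).2, logDeriv_apply]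
  rfl

/-- The series of the digamma function. -/
theorem hasSum_digamma {a z : ℂ} (ha : 0 < a.re) (hz : 0 < z.re) :
    HasSum (fun n : ℕ => 1 / ((n : ℂ) + a) - 1 / ((n : ℂ) + z)) (digamma z - digamma a) := by
  have h1 := (summable_inv_sub_inv ha hz).hasSum
  -- The index shift matches the $n+1$ factors in Gauss's formula; $\log n$ cancels in the
  -- difference of two digamma values.
  have h2 := h1.tendsto_sum_nat.comp (tendsto_add_atTop_nat 1)
  have h3 := (tendsto_digamma hz).sub (tendsto_digamma ha)
  have h4 := tendsto_nhds_unique h2 (h3.congr fun n => by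
    simp only [Function.comp_apply, Finset.sum_sub_distrib]
    ring)
  rwa [h4] at h1

/-- For $x\ge2$, $\Gamma(x)\le\lfloor x\rfloor!\le(1+x)^{1+x}$, and $\log(1+x)\le2(1+x)^{1/2}$ turns
this into the exponent $3/2$. Compactness covers $[\delta,2]$. -/
theorem exists_Gamma_le {δ : ℝ} (hδ : 0 < δ) :
    ∃ C : ℝ, 0 < C ∧ ∀ x : ℝ, δ ≤ x → Real.Gamma x ≤ Real.exp (C * (1 + x) ^ (3 / 2 : ℝ)) := by
  obtain ⟨M, hM⟩ := (isCompact_Icc (a := δ) (b := 2)).exists_bound_of_continuousOn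
    (f := Real.Gamma) (fun x hx => (Real.differentiableAt_Gamma fun m h => by
      have h1 := hx.1
      rw [h] at h1
      linarith [(Nat.cast_nonneg m : (0 : ℝ) ≤ m)]).continuousAt.continuousWithinAt)
  refine ⟨max 2 M, by positivity, fun x hx => ?_⟩
  have hx0 : 0 < x := hδ.trans_le hx
  rcases le_total x 2 with h2 | h2
  · calc Real.Gamma x ≤ M := (le_abs_self _).trans (hM x ⟨hx, h2⟩)
      _ ≤ max 2 M := le_max_right _ _
      _ ≤ max 2 M * (1 + x) ^ (3 / 2 : ℝ) :=
        le_mul_of_one_le_right (by positivity) (Real.one_le_rpow (by linarith) (by norm_num))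
      _ ≤ Real.exp (max 2 M * (1 + x) ^ (3 / 2 : ℝ)) := by
        linarith [Real.add_one_le_exp (max 2 M * (1 + x) ^ (3 / 2 : ℝ))]
  · have h3 : Real.Gamma x ≤ (⌊x⌋₊.factorial : ℝ) := by
      rw [← Real.Gamma_nat_eq_factorial]
      exact Real.Gamma_strictMonoOn_Ici.monotoneOn h2
        (h2.trans (Nat.lt_floor_add_one x).le) (Nat.lt_floor_add_one x).le
    have h4 : (⌊x⌋₊.factorial : ℝ) ≤ (1 + x) ^ (1 + x) := by
      calc (⌊x⌋₊.factorial : ℝ) ≤ (⌊x⌋₊ : ℝ) ^ ⌊x⌋₊ := by exact_mod_cast Nat.factorial_le_pow _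
        _ ≤ (1 + x) ^ (⌊x⌋₊ : ℝ) := by
          rw [Real.rpow_natCast]
          gcongr
          linarith [Nat.floor_le hx0.le]
        _ ≤ (1 + x) ^ (1 + x) := by
          refine Real.rpow_le_rpow_of_exponent_le (by linarith) ?_
          linarith [Nat.floor_le hx0.le]
    refine (h3.trans h4).trans ?_
    rw [Real.rpow_def_of_pos (by linarith)]
    refine Real.exp_le_exp.2 ?_
    have h5 := Real.log_le_rpow_div (x := 1 + x) (ε := 1 / 2) (by linarith) (by norm_num)
    have h6 : (1 + x) ^ (3 / 2 : ℝ) = (1 + x) ^ (1 / 2 : ℝ) * (1 + x) := by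
      rw [← Real.rpow_add_one (by linarith)]
      norm_num
    rw [h6]
    have h7 : 0 ≤ (1 + x) ^ (1 / 2 : ℝ) := by positivity
    calc Real.log (1 + x) * (1 + x) ≤ (1 + x) ^ (1 / 2 : ℝ) / (1 / 2) * (1 + x) := by gcongr
      _ = 2 * ((1 + x) ^ (1 / 2 : ℝ) * (1 + x)) := by ring
      _ ≤ _ := by gcongr; exact le_max_left _ _

end SelbergScrew
end

/-! ### Orders of vanishing, the gamma factor, and zero-freeness of $F$ for $\Re s>1$. -/

noncomputable section
namespace SelbergScrew

theorem analyticOrderNatAt_eq_of_eq_pow_mul {f g : ℂ → ℂ} {ρ : ℂ} {k : ℕ}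
    (hf : Differentiable ℂ f) (hg : Differentiable ℂ g) (hgρ : g ρ ≠ 0)
    (hfg : ∀ z, f z = (z - ρ) ^ k * g z) : analyticOrderNatAt f ρ = k := by
  have := ((hf.analyticAt ρ).analyticOrderAt_eq_natCast (n := k)).2
    ⟨g, hg.analyticAt ρ, hgρ, Eventually.of_forall hfg⟩
  rw [analyticOrderNatAt, this, ENat.toNat_natCast]

theorem analyticOrderNatAt_comp_const_add {f : ℂ → ℂ} (hf : Differentiable ℂ f)
    (h : ∃ z, f z ≠ 0) (c w : ℂ) :
    analyticOrderNatAt (fun w => f (c + w)) w = analyticOrderNatAt f (c + w) := by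
  obtain ⟨g, hg, hgρ, hfg⟩ := exists_eq_pow_order_mul hf h (c + w)
  refine analyticOrderNatAt_eq_of_eq_pow_mul (g := fun w => g (c + w)) (by fun_prop)
    (by fun_prop) hgρ fun z => ?_
  rw [hfg (c + z)]
  congr 2
  ring

theorem logDeriv_pow_mul {f g : ℂ → ℂ} {ρ : ℂ} {k : ℕ}
    (hg : Differentiable ℂ g) (hfg : ∀ z, f z = (z - ρ) ^ k * g z) {z : ℂ} (hz : z ≠ ρ)
    (hgz : g z ≠ 0) : logDeriv f z = k / (z - ρ) + logDeriv g z := by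
  have hf : f = fun z => (z - ρ) ^ k * g z := funext hfg
  have h0 : z - ρ ≠ 0 := sub_ne_zero.2 hz
  rw [hf, logDeriv_mul (f := fun z => (z - ρ) ^ k) (g := g) z (pow_ne_zero _ h0) hgz
    (by fun_prop) (hg z), logDeriv_fun_pow (f := fun z => z - ρ) (by fun_prop)]
  congr 1
  rw [logDeriv_apply]
  simp [div_eq_mul_inv]

theorem continuousAt_logDeriv {g : ℂ → ℂ} (hg : Differentiable ℂ g) {ρ : ℂ} (hgρ : g ρ ≠ 0) :
    ContinuousAt (logDeriv g) ρ := by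
  have h1 : Continuous (deriv g) := (hg.contDiff (n := 1)).continuous_deriv le_rfl
  exact h1.continuousAt.div hg.continuous.continuousAt hgρ

theorem tendsto_logDeriv_sub {f g : ℂ → ℂ} {ρ : ℂ} {k : ℕ}
    (hg : Differentiable ℂ g) (hgρ : g ρ ≠ 0) (hfg : ∀ z, f z = (z - ρ) ^ k * g z) :
    Tendsto (fun z => logDeriv f z - k / (z - ρ)) (𝓝[≠] ρ) (𝓝 (logDeriv g ρ)) := by
  refine ((continuousAt_logDeriv hg hgρ).tendsto.mono_left nhdsWithin_le_nhds).congr' ?_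
  filter_upwards [self_mem_nhdsWithin,
    nhdsWithin_le_nhds (hg.continuous.continuousAt.eventually_ne hgρ)] with z hz hgz
  rw [logDeriv_pow_mul hg hfg hz hgz]
  ring

/-- An entire function whose logarithmic derivative stays bounded near `ρ` does not vanish there. -/
theorem ne_zero_of_logDeriv_tendsto {f : ℂ → ℂ} (hf : Differentiable ℂ f) (h : ∃ z, f z ≠ 0)
    {ρ a : ℂ} (hlim : Tendsto (logDeriv f) (𝓝[≠] ρ) (𝓝 a)) : f ρ ≠ 0 := by
  obtain ⟨g, hg, hgρ, hfg⟩ := exists_eq_pow_order_mul hf h ρ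
  set k := analyticOrderNatAt f ρ
  have hsub : Tendsto (fun z : ℂ => z - ρ) (𝓝[≠] ρ) (𝓝 0) := by
    have : ContinuousAt (fun z : ℂ => z - ρ) ρ := by fun_prop
    simpa using this.tendsto.mono_left nhdsWithin_le_nhds
  -- Multiplying $f'/f-k/(z-\rho)$ by $z-\rho$ isolates the residue, which is the order $k$;
  -- boundedness of $f'/f$ forces $k=0$.
  have h1 := (hlim.sub (tendsto_logDeriv_sub hg hgρ hfg)).mul hsub
  rw [mul_zero] at h1
  have h2 : Tendsto (fun _ : ℂ => (k : ℂ)) (𝓝[≠] ρ) (𝓝 0) := by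
    refine h1.congr' ?_
    filter_upwards [self_mem_nhdsWithin] with z hz
    have : z - ρ ≠ 0 := sub_ne_zero.2 hz
    field_simp
    ring
  have h3 : (k : ℂ) = 0 := tendsto_nhds_unique tendsto_const_nhds h2
  rw [hfg, Nat.cast_eq_zero.1 h3]
  simpa using hgρ

namespace GammaData

variable (D : GammaData)

theorem re_arg_pos {s : ℂ} (hs : 0 < s.re) (j : Fin D.r) : 0 < ((D.lam j : ℂ) * s + D.mu j).re := by
  have := D.lam_pos j
  have := D.mu_re j
  simp
  positivity

theorem gammaFactor_ne_zero {s : ℂ} (hs : 0 < s.re) : D.gammaFactor s ≠ 0 := by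
  have hQ : (D.Q : ℂ) ≠ 0 := ofReal_ne_zero.2 D.Q_pos.ne'
  refine mul_ne_zero (by simp [cpow_eq_zero_iff, hQ]) (Finset.prod_ne_zero_iff.2 fun j _ => ?_)
  exact Gamma_ne_zero_of_re_pos (D.re_arg_pos hs j)

theorem hasDerivAt_Q_cpow (s : ℂ) :
    HasDerivAt (fun s : ℂ => (D.Q : ℂ) ^ s) ((D.Q : ℂ) ^ s * Real.log D.Q) s := by
  have hQ : (D.Q : ℂ) ≠ 0 := ofReal_ne_zero.2 D.Q_pos.ne'
  have := (hasDerivAt_id s).const_cpow (c := (D.Q : ℂ)) (Or.inl hQ)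
  rw [← ofReal_log D.Q_pos.le] at this
  simpa using this

theorem differentiableAt_Gamma_arg {s : ℂ} (hs : 0 < s.re) (j : Fin D.r) :
    DifferentiableAt ℂ (fun s => Gamma (D.lam j * s + D.mu j)) s :=
  DifferentiableAt.comp (g := Gamma) s (differentiableAt_Gamma_of_re_pos (D.re_arg_pos hs j))
    (by fun_prop)

theorem differentiableAt_gammaFactor {s : ℂ} (hs : 0 < s.re) :
    DifferentiableAt ℂ D.gammaFactor s := by
  unfold gammaFactor
  refine (D.hasDerivAt_Q_cpow s).differentiableAt.mul ?_
  exact DifferentiableAt.fun_finsetProd fun j _ => D.differentiableAt_Gamma_arg hs j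

/-- The logarithmic derivative of the gamma factor, for `Re s > 0`. -/
def gammaLog (s : ℂ) : ℂ :=
  Real.log D.Q + ∑ j, D.lam j * digamma (D.lam j * s + D.mu j)

theorem logDeriv_gammaFactor {s : ℂ} (hs : 0 < s.re) :
    logDeriv D.gammaFactor s = D.gammaLog s := by
  have hQ : (D.Q : ℂ) ≠ 0 := ofReal_ne_zero.2 D.Q_pos.ne'
  have hQs : (D.Q : ℂ) ^ s ≠ 0 := by simp [cpow_eq_zero_iff, hQ]
  have hG : ∀ j ∈ Finset.univ, Gamma (D.lam j * s + D.mu j) ≠ 0 := fun j _ =>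
    Gamma_ne_zero_of_re_pos (D.re_arg_pos hs j)
  unfold gammaFactor gammaLog
  rw [logDeriv_mul (f := fun s : ℂ => (D.Q : ℂ) ^ s)
    (g := fun s => ∏ j, Gamma (D.lam j * s + D.mu j)) s hQs
    (Finset.prod_ne_zero_iff.2 hG) (D.hasDerivAt_Q_cpow s).differentiableAt
    (DifferentiableAt.fun_finsetProd fun j _ => D.differentiableAt_Gamma_arg hs j),
    logDeriv_prod (f := fun j (s : ℂ) => Gamma (D.lam j * s + D.mu j)) hG
      (fun j _ => D.differentiableAt_Gamma_arg hs j)]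
  congr 1
  · rw [logDeriv_apply, (D.hasDerivAt_Q_cpow s).deriv]
    field_simp
  · refine Finset.sum_congr rfl fun j _ => ?_
    have h1 : HasDerivAt (fun s : ℂ => (D.lam j : ℂ) * s + D.mu j) (D.lam j) s := by
      simpa using ((hasDerivAt_id s).const_mul (D.lam j : ℂ)).add_const (D.mu j)
    have h2 := (differentiableAt_Gamma_of_re_pos (D.re_arg_pos hs j)).hasDerivAt.comp s h1
    rw [digamma_def, logDeriv_apply, logDeriv_apply]
    have h3 : deriv (fun s : ℂ => Gamma (D.lam j * s + D.mu j)) s = _ := h2.deriv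
    rw [h3]
    ring

/-- Since $|\Gamma(s)|\le\Gamma(\Re s)$, the bound depends on $\Re s$ alone, which keeps the gamma
factor bounded on vertical strips. -/
theorem exists_gammaFactor_le : ∃ K B : ℝ, 0 < K ∧ 0 < B ∧ ∀ s : ℂ, 1 / 2 ≤ s.re →
    ‖D.gammaFactor s‖ ≤ K * Real.exp (B * (1 + s.re) ^ (3 / 2 : ℝ)) := by
  have h1 : ∀ j : Fin D.r, ∃ B : ℝ, 0 < B ∧ ∀ s : ℂ, 1 / 2 ≤ s.re →
      ‖Gamma (D.lam j * s + D.mu j)‖ ≤ Real.exp (B * (1 + s.re) ^ (3 / 2 : ℝ)) := by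
    intro j
    have hl := D.lam_pos j
    have hm := D.mu_re j
    obtain ⟨C, hC, hCb⟩ := exists_Gamma_le (δ := D.lam j / 2) (by positivity)
    refine ⟨C * (1 + D.lam j + (D.mu j).re) ^ (3 / 2 : ℝ), by positivity, fun s hs => ?_⟩
    have hre : ((D.lam j : ℂ) * s + D.mu j).re = D.lam j * s.re + (D.mu j).re := by simp
    have hpos := D.re_arg_pos (s := s) (by linarith) j
    refine (norm_Gamma_le hpos).trans ((hCb _ ?_).trans ?_)
    · rw [hre]; nlinarith
    · refine Real.exp_le_exp.2 ?_
      rw [mul_assoc, ← Real.mul_rpow (by positivity) (by linarith)]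
      gcongr
      rw [hre]
      nlinarith [mul_nonneg hm (by linarith : (0:ℝ) ≤ s.re)]
  choose B hB hBb using h1
  refine ⟨1, |Real.log D.Q| + 1 + ∑ j, B j, one_pos,
    by have := Finset.sum_nonneg fun j (_ : j ∈ Finset.univ) => (hB j).le; positivity,
    fun s hs => ?_⟩
  rw [one_mul, gammaFactor, norm_mul, norm_prod, add_mul, Real.exp_add, Finset.sum_mul,
    Real.exp_sum]
  have hx : s.re ≤ (1 + s.re) ^ (3 / 2 : ℝ) := by
    calc s.re ≤ (1 + s.re) ^ (1 : ℝ) := by rw [Real.rpow_one]; linarith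
      _ ≤ _ := Real.rpow_le_rpow_of_exponent_le (by linarith) (by norm_num)
  refine mul_le_mul ?_ (Finset.prod_le_prod (fun _ _ => norm_nonneg _) fun j _ => hBb j s hs)
    (Finset.prod_nonneg fun _ _ => norm_nonneg _) (Real.exp_pos _).le
  rw [norm_cpow_eq_rpow_re_of_pos D.Q_pos, Real.rpow_def_of_pos D.Q_pos]
  refine Real.exp_le_exp.2 ?_
  have h2 := le_abs_self (Real.log D.Q)
  have h3 := abs_nonneg (Real.log D.Q)
  have h4 : 0 ≤ s.re := by linarith
  calc Real.log D.Q * s.re ≤ |Real.log D.Q| * s.re := by gcongr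
    _ ≤ |Real.log D.Q| * (1 + s.re) ^ (3 / 2 : ℝ) := by gcongr
    _ ≤ _ := by gcongr; linarith

end GammaData

/-- `G` is the entire function `(s - 1)^{m_F} F(s)`. -/
structure EntireExtension (F G : ℂ → ℂ) : Prop where
  diff : Differentiable ℂ G
  order : HasFiniteOrder G
  eq : ∀ s : ℂ, s ≠ 1 → G s = (s - 1) ^ poleOrder F * F s

theorem ExtendedSelbergClass.exists_entireExtension {F : ℂ → ℂ} (hF : ExtendedSelbergClass F) :
    ∃ G, EntireExtension F G := by
  obtain ⟨G, h1, h2, h3⟩ : ExtendsWith F (poleOrder F) := Nat.sInf_mem hF.continuation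
  exact ⟨G, h1, h2, h3⟩

namespace EntireExtension

variable {F G : ℂ → ℂ}

theorem eventuallyEq (hG : EntireExtension F G) {s : ℂ} (hs : s ≠ 1) :
    F =ᶠ[𝓝 s] fun s => G s / (s - 1) ^ poleOrder F := by
  filter_upwards [isOpen_ne.mem_nhds hs] with z hz
  have : (z - 1) ^ poleOrder F ≠ 0 := pow_ne_zero _ (sub_ne_zero.2 hz)
  rw [hG.eq z hz]
  field_simp

theorem differentiableAt (hG : EntireExtension F G) {s : ℂ} (hs : s ≠ 1) : DifferentiableAt ℂ F s := by
  refine (hG.eventuallyEq hs).differentiableAt_iff.2 ?_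
  exact (hG.diff s).div (by fun_prop) (pow_ne_zero _ (sub_ne_zero.2 hs))

theorem exists_ne_zero (hG : EntireExtension F G) (hF : ExtendedSelbergClass F) : ∃ s, G s ≠ 0 := by
  obtain ⟨s, hs, hFs⟩ := hF.not_zero
  exact ⟨s, by rw [hG.eq s hs]; exact mul_ne_zero (pow_ne_zero _ (sub_ne_zero.2 hs)) hFs⟩

theorem logDeriv_eq (hG : EntireExtension F G) {s : ℂ} (hs : s ≠ 1) (hFs : F s ≠ 0) :
    logDeriv G s = poleOrder F / (s - 1) + logDeriv F s := by
  have h1 : G =ᶠ[𝓝 s] fun s => (s - 1) ^ poleOrder F * F s := by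
    filter_upwards [isOpen_ne.mem_nhds hs] with z hz using hG.eq z hz
  have h0 : s - 1 ≠ 0 := sub_ne_zero.2 hs
  have h2 : logDeriv G s = logDeriv (fun s => (s - 1) ^ poleOrder F * F s) s := by
    rw [logDeriv_apply, logDeriv_apply, h1.deriv_eq, h1.eq_of_nhds]
  rw [h2, logDeriv_mul (f := fun z : ℂ => (z - 1) ^ poleOrder F) (g := F) s (pow_ne_zero _ h0) hFs
    (by fun_prop) (hG.differentiableAt hs), logDeriv_fun_pow (f := fun z : ℂ => z - 1) (by fun_prop)]
  congr 1
  rw [logDeriv_apply]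
  simp [div_eq_mul_inv]

theorem ne_one_of_one_lt_re {s : ℂ} (hs : 1 < s.re) : s ≠ 1 := by
  rintro rfl
  simp at hs

/-- A zero of $F$ would give $F'/F$ a pole, whereas the Dirichlet series is continuous. The argument
runs over a punctured neighbourhood: at a zero itself `logDeriv` takes the default value $0$, so the
identity at that single point carries no contradiction. -/
theorem ne_zero (hG : EntireExtension F G) (hF : SemiExtendedSelbergClass F) {s : ℂ} (hs : 1 < s.re) : F s ≠ 0 := by
  obtain ⟨c, hc⟩ := hF.euler_sum
  have hGs : G s ≠ 0 := by
    have habs : LSeries.abscissaOfAbsConv c ≤ 1 :=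
      LSeries.abscissaOfAbsConv_le_of_forall_lt_LSeriesSummable fun y hy =>
        (hc.hasSum y (by simpa using hy)).LSeriesSummable
    have hcont : ContinuousAt (LSeries c) s :=
      (LSeries_hasDerivAt (habs.trans_lt (by exact_mod_cast hs))).continuousAt
    have hnhds : ∀ᶠ z : ℂ in 𝓝 s, 1 < z.re :=
      (isOpen_lt continuous_const continuous_re).mem_nhds hs
    have hs1 : s - 1 ≠ 0 := sub_ne_zero.2 (ne_one_of_one_lt_re hs)
    have hlim : Tendsto (fun z => poleOrder F / (z - 1) - LSeries c z) (𝓝[≠] s)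
        (𝓝 (poleOrder F / (s - 1) - LSeries c s)) := by
      have h1 : ContinuousAt (fun z : ℂ => (poleOrder F : ℂ) / (z - 1)) s :=
        ContinuousAt.div (by fun_prop) (by fun_prop) hs1
      exact (h1.tendsto.sub hcont.tendsto).mono_left nhdsWithin_le_nhds
    refine ne_zero_of_logDeriv_tendsto hG.diff (hG.exists_ne_zero hF.toExtendedSelbergClass)
      (hlim.congr' ?_)
    have hGne : ∀ᶠ z in 𝓝[≠] s, G z ≠ 0 := by
      refine ((hG.diff.analyticAt s).eventually_eq_zero_or_eventually_ne_zero).resolve_left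
        fun h => ?_
      exact analyticOrderAt_ne_top_of_entire hG.diff
        (hG.exists_ne_zero hF.toExtendedSelbergClass) s (analyticOrderAt_eq_top.2 h)
    filter_upwards [nhdsWithin_le_nhds hnhds, hGne] with z hz hGz
    have hz1 := ne_one_of_one_lt_re hz
    have hFz : F z ≠ 0 := fun h0 => hGz (by rw [hG.eq z hz1, h0, mul_zero])
    rw [hG.logDeriv_eq hz1 hFz, (hc.hasSum z hz).LSeries_eq]
    ring
  intro h0
  exact hGs (by rw [hG.eq s (ne_one_of_one_lt_re hs), h0, mul_zero])

end EntireExtension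

end SelbergScrew
end

/-! ### The function $\xi_F$: entirety, zeros and growth. -/

noncomputable section
namespace SelbergScrew

variable {F G : ℂ → ℂ} {D : GammaData}

/-- Each gamma value is the inverse of the entire function $1/\Gamma$. -/
theorem GammaData.meromorphic_gammaFactor (D : GammaData) (s : ℂ) :
    MeromorphicAt D.gammaFactor s := by
  unfold GammaData.gammaFactor
  have h1 : Differentiable ℂ fun s : ℂ => (D.Q : ℂ) ^ s := fun s =>
    (D.hasDerivAt_Q_cpow s).differentiableAt
  refine (h1.analyticAt s).meromorphicAt.mul ?_
  refine MeromorphicAt.fun_prod fun j _ => ?_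
  have h2 : Differentiable ℂ fun s : ℂ => (Gamma (D.lam j * s + D.mu j))⁻¹ :=
    differentiable_one_div_Gamma.comp (by fun_prop)
  have h3 := (h2.analyticAt s).meromorphicAt.inv
  exact h3.congr (Eventually.of_forall fun z => by simp)

theorem meromorphicOn_xiProduct (hG : EntireExtension F G) (D : GammaData) :
    MeromorphicOn (xiProduct F D) Set.univ := by
  intro s _
  unfold xiProduct
  have hF : MeromorphicAt F s := by
    have h1 : MeromorphicAt (fun s => G s / (s - 1) ^ poleOrder F) s := by
      have h2 : Differentiable ℂ fun s : ℂ => (s - 1) ^ poleOrder F := by fun_prop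
      exact (hG.diff.analyticAt s).meromorphicAt.div (h2.analyticAt s).meromorphicAt
    refine h1.congr ?_
    by_cases hs : s = 1
    · subst hs
      filter_upwards [self_mem_nhdsWithin] with z hz
      exact (hG.eventuallyEq hz).eq_of_nhds.symm
    · exact nhdsWithin_le_nhds (hG.eventuallyEq hs).symm
  have h3 : Differentiable ℂ fun s : ℂ => s ^ poleOrder F * (s - 1) ^ poleOrder F := by fun_prop
  exact ((h3.analyticAt s).meromorphicAt.mul (D.meromorphic_gammaFactor s)).mul hF

/-- The expression of `ξ_F` through the entire function `(s - 1)^{m_F} F(s)`. -/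
def xiRight (F G : ℂ → ℂ) (D : GammaData) (s : ℂ) : ℂ := s ^ poleOrder F * D.gammaFactor s * G s

theorem differentiableAt_xiRight (hG : EntireExtension F G) {s : ℂ} (hs : 0 < s.re) :
    DifferentiableAt ℂ (xiRight F G D) s :=
  ((differentiableAt_fun_id.pow _).mul (D.differentiableAt_gammaFactor hs)).mul (hG.diff s)

/-- The two products agree off $s=1$ and the right one is holomorphic, so the normal form selects
its value. The arbitrary value of $F$ at $1$ is thereby discarded. -/
theorem xi_eq_xiRight (hG : EntireExtension F G) {s : ℂ} (hs : 0 < s.re) :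
    xi F D s = xiRight F G D s := by
  have hmer := meromorphicOn_xiProduct hG D
  rw [xi, toMeromorphicNFOn_eq_toMeromorphicNFAt hmer (Set.mem_univ s)]
  have han : AnalyticAt ℂ (xiRight F G D) s := by
    refine DifferentiableOn.analyticAt (s := {s : ℂ | 0 < s.re}) (fun z hz =>
      (differentiableAt_xiRight hG hz).differentiableWithinAt) (isOpen_re_pos.mem_nhds hs)
  have heq : xiProduct F D =ᶠ[𝓝[≠] s] xiRight F G D := by
    have h1 : ∀ᶠ z in 𝓝[≠] s, z ≠ 1 := by
      by_cases h : s = 1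
      · subst h; exact self_mem_nhdsWithin
      · exact nhdsWithin_le_nhds (isOpen_ne.mem_nhds h)
    filter_upwards [h1] with z hz
    rw [xiProduct, xiRight, hG.eq z hz]
    ring
  rw [(toMeromorphicNFAt_eventuallyEq_nhds_congr heq).eq_of_nhds,
    toMeromorphicNFAt_eq_self.2 han.meromorphicNFAt]

/-- The expression `xiRight` settles $\Re s>0$; the functional equation carries $\Re s\le0$ to $\Re
s\ge1$. -/
theorem differentiable_xi (hG : EntireExtension F G) (hD : FunctionalEquation F D) :
    Differentiable ℂ (xi F D) := by
  have h1 : ∀ s : ℂ, 0 < s.re → DifferentiableAt ℂ (xi F D) s := by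
    intro s hs
    refine Filter.EventuallyEq.differentiableAt_iff (f₀ := xi F D) (f₁ := xiRight F G D) ?_ |>.2
      (differentiableAt_xiRight hG hs)
    filter_upwards [isOpen_re_pos.mem_nhds hs] with z hz using xi_eq_xiRight hG hz
  intro s
  rcases lt_or_ge 0 s.re with hs | hs
  · exact h1 s hs
  · have h2 : xi F D = fun s => D.ω * (starRingEnd ℂ)
        ((fun z => xi F D (1 - z)) ((starRingEnd ℂ) s)) := funext hD
    rw [h2]
    have h3 : DifferentiableAt ℂ (fun z => xi F D (1 - z)) ((starRingEnd ℂ) s) := ?_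
    · exact (differentiableAt_conj_conj_iff.2 h3).const_mul _
    refine DifferentiableAt.comp (g := xi F D) _ (h1 _ ?_) (by fun_prop)
    simp
    linarith

theorem norm_xi_reflect (hD : FunctionalEquation F D) (s : ℂ) :
    ‖xi F D s‖ = ‖xi F D (1 - (starRingEnd ℂ) s)‖ := by
  conv_lhs => rw [hD s]
  rw [norm_mul, D.norm_ω, one_mul, norm_conj]

theorem xi_ne_zero_of_one_lt_re (hF : SemiExtendedSelbergClass F) (hG : EntireExtension F G)
    {s : ℂ} (hs : 1 < s.re) : xi F D s ≠ 0 := by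
  have h0 : 0 < s.re := by linarith
  rw [xi_eq_xiRight hG h0, xiRight, hG.eq s (EntireExtension.ne_one_of_one_lt_re hs)]
  refine mul_ne_zero (mul_ne_zero (pow_ne_zero _ fun h => ?_) (D.gammaFactor_ne_zero h0))
    (mul_ne_zero (pow_ne_zero _ (sub_ne_zero.2 (EntireExtension.ne_one_of_one_lt_re hs)))
      (hG.ne_zero hF hs))
  simp [h] at h0

theorem re_mem_Icc_of_xi_eq_zero (hF : SemiExtendedSelbergClass F) (hG : EntireExtension F G)
    (hD : FunctionalEquation F D) {s : ℂ} (hs : xi F D s = 0) : 0 ≤ s.re ∧ s.re ≤ 1 := by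
  constructor
  · by_contra! h
    refine xi_ne_zero_of_one_lt_re hF hG (D := D) (s := 1 - (starRingEnd ℂ) s) ?_ ?_
    · simp; linarith
    · rw [← norm_eq_zero, ← norm_xi_reflect hD, hs, norm_zero]
  · by_contra! h
    exact xi_ne_zero_of_one_lt_re hF hG h hs

theorem logDeriv_xi (hF : SemiExtendedSelbergClass F) (hG : EntireExtension F G)
    {s : ℂ} (hs : 1 < s.re) : logDeriv (xi F D) s
      = poleOrder F / s + poleOrder F / (s - 1) + logDeriv F s + D.gammaLog s := by
  have h0 : 0 < s.re := by linarith
  have hs0 : s ≠ 0 := by rintro rfl; simp at h0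
  have hs1 := EntireExtension.ne_one_of_one_lt_re hs
  have hFs := hG.ne_zero hF hs
  have hGs : G s ≠ 0 := by
    rw [hG.eq s hs1]
    exact mul_ne_zero (pow_ne_zero _ (sub_ne_zero.2 hs1)) hFs
  have h1 : xi F D =ᶠ[𝓝 s] xiRight F G D := by
    filter_upwards [isOpen_re_pos.mem_nhds h0] with z hz using xi_eq_xiRight hG hz
  have h2 : logDeriv (xi F D) s = logDeriv (xiRight F G D) s := by
    rw [logDeriv_apply, logDeriv_apply, h1.deriv_eq, h1.eq_of_nhds]
  have h3 : logDeriv (fun s : ℂ => s ^ poleOrder F) s = poleOrder F / s := by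
    rw [logDeriv_fun_pow (f := fun z : ℂ => z) (by fun_prop), logDeriv_apply]
    simp [div_eq_mul_inv]
  rw [h2]
  unfold xiRight
  rw [logDeriv_mul (f := fun s => s ^ poleOrder F * D.gammaFactor s) (g := G) s
    (mul_ne_zero (pow_ne_zero _ hs0) (D.gammaFactor_ne_zero h0)) hGs
    ((differentiableAt_fun_id.pow _).mul (D.differentiableAt_gammaFactor h0)) (hG.diff s),
    logDeriv_mul (f := fun s : ℂ => s ^ poleOrder F) (g := D.gammaFactor) s (pow_ne_zero _ hs0)
    (D.gammaFactor_ne_zero h0) (by fun_prop) (D.differentiableAt_gammaFactor h0), h3,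
    D.logDeriv_gammaFactor h0, hG.logDeriv_eq hs1 hFs]
  ring

theorem ExtendedSelbergClass.exists_norm_le (hF : ExtendedSelbergClass F) :
    ∃ K : ℝ, 0 < K ∧ ∀ s : ℂ, 2 ≤ s.re → ‖F s‖ ≤ K := by
  obtain ⟨a, ha⟩ := hF.dirichlet_series
  have h2 : Summable fun n => ‖LSeries.term a 2 n‖ := (ha 2 (by simp)).LSeriesSummable.norm
  refine ⟨(∑' n, ‖LSeries.term a 2 n‖) + 1,
    by have : 0 ≤ ∑' n, ‖LSeries.term a 2 n‖ := tsum_nonneg fun n => norm_nonneg _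
       positivity, fun s hs => ?_⟩
  have h3 : ∀ n, ‖LSeries.term a s n‖ ≤ ‖LSeries.term a 2 n‖ := fun n =>
    LSeries.norm_term_le_of_re_le_re a (by simpa using hs) n
  rw [← (ha s (by linarith)).LSeries_eq, LSeries]
  have := tsum_of_norm_bounded h2.hasSum h3
  linarith

theorem exists_xi_le_right (hF : ExtendedSelbergClass F) (hG : EntireExtension F G) :
    ∃ K B : ℝ, 0 < K ∧ 0 < B ∧ ∀ s : ℂ, 2 ≤ s.re →
      ‖xi F D s‖ ≤ K * (1 + ‖s‖) ^ (2 * poleOrder F) * Real.exp (B * (1 + s.re) ^ (3 / 2 : ℝ)) := by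
  obtain ⟨K, B, hK, hB, h1⟩ := D.exists_gammaFactor_le
  obtain ⟨K', hK', h2⟩ := hF.exists_norm_le
  refine ⟨K * K', B, by positivity, hB, fun s hs => ?_⟩
  have hs1 : s ≠ 1 := EntireExtension.ne_one_of_one_lt_re (by linarith)
  rw [xi_eq_xiRight hG (by linarith), xiRight, hG.eq s hs1]
  simp only [norm_mul, norm_pow]
  have h3 : ‖s - 1‖ ≤ 1 + ‖s‖ := by
    have := norm_sub_le s 1
    rw [norm_one] at this
    linarith
  calc ‖s‖ ^ poleOrder F * ‖D.gammaFactor s‖ * (‖s - 1‖ ^ poleOrder F * ‖F s‖)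
      ≤ (1 + ‖s‖) ^ poleOrder F * (K * Real.exp (B * (1 + s.re) ^ (3 / 2 : ℝ)))
        * ((1 + ‖s‖) ^ poleOrder F * K') := by
        gcongr
        · linarith
        · exact h1 s (by linarith)
        · exact h2 s hs
    _ = _ := by ring

theorem pow_le_factorial_mul_exp {x : ℝ} (hx : 0 ≤ x) (n : ℕ) :
    x ^ n ≤ n.factorial * Real.exp x := by
  have := Real.pow_div_factorial_le_exp x hx n
  rwa [div_le_iff₀ (by positivity), mul_comm] at this

/-- A crude bound, in which finite order is weakened to a double exponential of rate $1$: this is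
the a priori growth that Phragmén–Lindelöf asks for. -/
theorem exists_xi_le_strip_right (hG : EntireExtension F G) :
    ∃ K B : ℝ, 0 < K ∧ 0 < B ∧ ∀ s : ℂ, 1 / 2 ≤ s.re → s.re ≤ 2 →
      ‖xi F D s‖ ≤ K * Real.exp (B * Real.exp ‖s‖) := by
  obtain ⟨K, B, hK, hB, h1⟩ := D.exists_gammaFactor_le
  obtain ⟨ρ, C, h2⟩ := hG.order
  refine ⟨(poleOrder F).factorial * (K * Real.exp (B * (1 + 2) ^ (3 / 2 : ℝ))) * (|C| + 1),
    1 + ρ.factorial, by positivity, by positivity, fun s hs hs2 => ?_⟩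
  rw [xi_eq_xiRight hG (by linarith), xiRight]
  simp only [norm_mul, norm_pow]
  have h3 : ‖G s‖ ≤ (|C| + 1) * Real.exp (ρ.factorial * Real.exp ‖s‖) := by
    refine (h2 s).trans ?_
    gcongr
    · linarith [le_abs_self C]
    · exact pow_le_factorial_mul_exp (norm_nonneg s) ρ
  have h4 : ‖s‖ ^ poleOrder F ≤ (poleOrder F).factorial * Real.exp (Real.exp ‖s‖) := by
    refine (pow_le_factorial_mul_exp (norm_nonneg s) _).trans ?_
    gcongr
    linarith [Real.add_one_le_exp ‖s‖]
  have h5 : ‖D.gammaFactor s‖ ≤ K * Real.exp (B * (1 + 2) ^ (3 / 2 : ℝ)) := by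
    refine (h1 s hs).trans ?_
    gcongr
  calc ‖s‖ ^ poleOrder F * ‖D.gammaFactor s‖ * ‖G s‖
      ≤ ((poleOrder F).factorial * Real.exp (Real.exp ‖s‖))
        * (K * Real.exp (B * (1 + 2) ^ (3 / 2 : ℝ)))
        * ((|C| + 1) * Real.exp (ρ.factorial * Real.exp ‖s‖)) := by gcongr
    _ = _ := by
      rw [add_mul (1 : ℝ), Real.exp_add, one_mul]
      ring

theorem norm_reflect_le (s : ℂ) : ‖1 - (starRingEnd ℂ) s‖ ≤ 1 + ‖s‖ := by
  have := norm_sub_le 1 ((starRingEnd ℂ) s)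
  rwa [norm_one, norm_conj] at this

/-- Phragmén–Lindelöf for $\xi_F(s)/(s+3)^m$ on $-1\le\Re s\le2$. The shift $3$ is chosen because
$1-\bar s=s+3$ on $\Re s=-1$, so the functional equation transports the bound from $\Re s=2$
exactly. -/
theorem exists_xi_le_strip (hF : ExtendedSelbergClass F) (hG : EntireExtension F G)
    (hD : FunctionalEquation F D) :
    ∃ K : ℝ, 0 < K ∧ ∀ s : ℂ, -1 ≤ s.re → s.re ≤ 2 →
      ‖xi F D s‖ ≤ K * (3 + ‖s‖) ^ (2 * poleOrder F) := by
  obtain ⟨K, B, hK, hB, h1⟩ := exists_xi_le_strip_right (D := D) hG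
  obtain ⟨K', B', hK', hB', h2⟩ := exists_xi_le_right (D := D) hF hG
  have hstrip : ∀ s : ℂ, -1 ≤ s.re → s.re ≤ 2 →
      ‖xi F D s‖ ≤ K * Real.exp (B * Real.exp (1 + ‖s‖)) := by
    intro s hs hs2
    rcases le_total (1 / 2) s.re with h | h
    · refine (h1 s h hs2).trans ?_
      gcongr
      linarith
    · rw [norm_xi_reflect hD]
      refine (h1 _ (by simp; linarith) (by simp; linarith)).trans ?_
      gcongr
      exact norm_reflect_le s
  set m := 2 * poleOrder F
  let M : ℝ := K' * 3 ^ m * Real.exp (B' * (1 + 2) ^ (3 / 2 : ℝ))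
  have h3 : ∀ s : ℂ, -1 ≤ s.re → 2 ≤ ‖s + 3‖ := by
    intro s hs
    have := re_le_norm (s + 3)
    simp at this
    linarith
  have hline : ∀ s : ℂ, s.re = 2 → ‖xi F D s‖ ≤ M * ‖s‖ ^ m := by
    intro s hs
    refine (h2 s hs.ge).trans ?_
    rw [hs]
    have : 1 + ‖s‖ ≤ 3 * ‖s‖ := by
      have := re_le_norm s
      linarith
    calc K' * (1 + ‖s‖) ^ m * Real.exp (B' * (1 + 2) ^ (3 / 2 : ℝ))
        ≤ K' * (3 * ‖s‖) ^ m * Real.exp (B' * (1 + 2) ^ (3 / 2 : ℝ)) := by gcongr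
      _ = M * ‖s‖ ^ m := by simp only [M]; rw [mul_pow]; ring
  have hPL : ∀ s : ℂ, -1 ≤ s.re → s.re ≤ 2 → ‖xi F D s / (s + 3) ^ m‖ ≤ M := by
    intro s hs hs2
    refine PhragmenLindelof.vertical_strip (f := fun s => xi F D s / (s + 3) ^ m) (a := -1) (b := 2)
      ?_ ?_ ?_ ?_ hs hs2
    · refine DifferentiableOn.diffContOnCl fun z hz => ?_
      have hz' : -1 ≤ z.re := by
        have : closure (re ⁻¹' Set.Ioo (-1) 2) ⊆ {z : ℂ | -1 ≤ z.re} :=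
          closure_minimal (fun z hz => hz.1.le) (isClosed_le continuous_const continuous_re)
        exact this hz
      have hne : z + 3 ≠ 0 := norm_pos_iff.1 (by linarith [h3 z hz'])
      have hpow : DifferentiableAt ℂ (fun z : ℂ => (z + 3) ^ m) z := by fun_prop
      have hpow0 : (z + 3) ^ m ≠ 0 := pow_ne_zero _ hne
      exact ((differentiable_xi hG hD z).div hpow hpow0).differentiableWithinAt
    -- The strip has width $3$, and the admissible rates are those below $\pi/3$; rate $1$ qualifies
    -- because $\pi>3$.
    · refine ⟨1, by linarith [Real.pi_gt_three], B * Real.exp 3, ?_⟩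
      refine Asymptotics.IsBigO.of_bound K ?_
      refine mem_inf_of_right ?_
      intro z hz
      simp only [Set.mem_preimage, Set.mem_Ioo] at hz
      show ‖xi F D z / (z + 3) ^ m‖ ≤ K * ‖Real.exp (B * Real.exp 3 * Real.exp (1 * |z.im|))‖
      rw [norm_div, norm_pow, Real.norm_eq_abs, abs_of_pos (Real.exp_pos _)]
      have h4 : (1 : ℝ) ≤ ‖z + 3‖ ^ m := one_le_pow₀ (by linarith [h3 z hz.1.le])
      refine (div_le_self (norm_nonneg _) h4).trans ((hstrip z hz.1.le hz.2.le).trans ?_)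
      rw [mul_assoc B, ← Real.exp_add]
      refine mul_le_mul_of_nonneg_left (Real.exp_le_exp.2
        (mul_le_mul_of_nonneg_left (Real.exp_le_exp.2 ?_) hB.le)) hK.le
      have := norm_le_abs_re_add_abs_im z
      have : |z.re| ≤ 2 := abs_le.2 ⟨by linarith, hz.2.le⟩
      linarith
    · intro z hz
      have hz3 := h3 z hz.ge
      rw [norm_div, norm_pow, div_le_iff₀ (by positivity), norm_xi_reflect hD]
      have h5 := hline (1 - (starRingEnd ℂ) z) (by simp [hz]; norm_num)
      refine h5.trans (le_of_eq ?_)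
      have : 1 - (starRingEnd ℂ) z = z + 3 := by
        apply Complex.ext <;> simp [hz]
        norm_num
      rw [this]
    · intro z hz
      have hz3 := h3 z (by linarith)
      rw [norm_div, norm_pow, div_le_iff₀ (by positivity)]
      refine (hline z hz).trans ?_
      have h6 : ‖z‖ ≤ ‖z + 3‖ := by
        rw [norm_def, norm_def]
        refine Real.sqrt_le_sqrt ?_
        simp [normSq_apply, hz]
        norm_num
      have : 0 ≤ M := by positivity
      gcongr
  refine ⟨M, by positivity, fun s hs hs2 => ?_⟩
  have h7 := hPL s hs hs2
  have h8 := h3 s hs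
  rw [norm_div, norm_pow, div_le_iff₀ (by positivity)] at h7
  refine h7.trans ?_
  have : ‖s + 3‖ ≤ 3 + ‖s‖ := by
    have := norm_add_le s 3
    simp at this
    linarith
  have : 0 ≤ M := by positivity
  gcongr

/-- Three regions: $\Re s\ge2$ by the Dirichlet series, $\Re s\le-1$ by reflection, and the strip
between them by its polynomial bound. -/
theorem exists_xi_le (hF : ExtendedSelbergClass F) (hG : EntireExtension F G)
    (hD : FunctionalEquation F D) :
    ∃ K B : ℝ, 0 < K ∧ 0 < B ∧ ∀ s : ℂ,
      ‖xi F D s‖ ≤ K * Real.exp (B * (1 + ‖s‖) ^ (3 / 2 : ℝ)) := by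
  obtain ⟨K, hK, h1⟩ := exists_xi_le_strip hF hG hD
  obtain ⟨K', B, hK', hB, h2⟩ := exists_xi_le_right (D := D) hF hG
  set m := 2 * poleOrder F
  have hx : ∀ x : ℝ, 0 ≤ x → 1 + x ≤ (1 + x) ^ (3 / 2 : ℝ) := by
    intro x hx
    calc 1 + x = (1 + x) ^ (1 : ℝ) := (Real.rpow_one _).symm
      _ ≤ _ := Real.rpow_le_rpow_of_exponent_le (by linarith) (by norm_num)
  have hpow : ∀ x : ℝ, 0 ≤ x → (3 + x) ^ m ≤ 3 ^ m * (m.factorial * Real.exp ((1 + x) ^ (3 / 2 : ℝ))) := by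
    intro x hx0
    calc (3 + x) ^ m ≤ (3 * (1 + x)) ^ m := by gcongr; linarith
      _ = 3 ^ m * (1 + x) ^ m := mul_pow _ _ _
      _ ≤ 3 ^ m * (m.factorial * Real.exp (1 + x)) := by
        gcongr
        exact pow_le_factorial_mul_exp (by linarith) m
      _ ≤ _ := by gcongr; exact hx x hx0
  have hright : ∀ s : ℂ, 2 ≤ s.re → ‖xi F D s‖ ≤ K' * (3 ^ m * m.factorial)
      * Real.exp ((1 + B) * (1 + ‖s‖) ^ (3 / 2 : ℝ)) := by
    intro s hs
    have h4 : (1 + ‖s‖) ^ m ≤ 3 ^ m * (m.factorial * Real.exp ((1 + ‖s‖) ^ (3 / 2 : ℝ))) := by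
      refine le_trans ?_ (hpow ‖s‖ (norm_nonneg s))
      gcongr
      norm_num
    calc ‖xi F D s‖ ≤ K' * (1 + ‖s‖) ^ m * Real.exp (B * (1 + s.re) ^ (3 / 2 : ℝ)) := h2 s hs
      _ ≤ K' * (3 ^ m * (m.factorial * Real.exp ((1 + ‖s‖) ^ (3 / 2 : ℝ))))
          * Real.exp (B * (1 + ‖s‖) ^ (3 / 2 : ℝ)) := by
        gcongr
        exact re_le_norm s
      _ = _ := by rw [add_mul 1 B, Real.exp_add, one_mul]; ring
  have h2r : (0 : ℝ) < 2 ^ (3 / 2 : ℝ) := by positivity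
  have h2r1 : (1 : ℝ) ≤ 2 ^ (3 / 2 : ℝ) := Real.one_le_rpow (by norm_num) (by norm_num)
  refine ⟨(K + K') * (3 ^ m * m.factorial), (1 + B) * 2 ^ (3 / 2 : ℝ), by positivity,
    by positivity, fun s => ?_⟩
  have hexp : ∀ x : ℝ, 0 ≤ x → x ≤ 1 + ‖s‖ →
      Real.exp ((1 + B) * (1 + x) ^ (3 / 2 : ℝ))
        ≤ Real.exp ((1 + B) * 2 ^ (3 / 2 : ℝ) * (1 + ‖s‖) ^ (3 / 2 : ℝ)) := by
    intro x hx0 hx1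
    rw [mul_assoc (1 + B), ← Real.mul_rpow (by norm_num) (by positivity)]
    gcongr
    linarith [norm_nonneg s]
  rcases le_total 2 s.re with hs | hs
  · refine (hright s hs).trans ?_
    gcongr
    · linarith
    · nlinarith
  rcases le_total s.re (-1) with hs' | hs'
  · rw [norm_xi_reflect hD]
    refine (hright _ (by simp; linarith)).trans ?_
    refine mul_le_mul (by gcongr; linarith) (hexp _ (norm_nonneg _) (norm_reflect_le s))
      (Real.exp_pos _).le (by positivity)
  · refine (h1 s hs' hs).trans ?_
    have h5 : Real.exp ((1 + ‖s‖) ^ (3 / 2 : ℝ))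
        ≤ Real.exp ((1 + B) * 2 ^ (3 / 2 : ℝ) * (1 + ‖s‖) ^ (3 / 2 : ℝ)) := by
      refine Real.exp_le_exp.2 (le_mul_of_one_le_left (by positivity) ?_)
      nlinarith
    calc K * (3 + ‖s‖) ^ m ≤ K * (3 ^ m * (m.factorial * Real.exp ((1 + ‖s‖) ^ (3 / 2 : ℝ)))) := by
          gcongr
          exact hpow _ (norm_nonneg s)
      _ = K * (3 ^ m * m.factorial) * Real.exp ((1 + ‖s‖) ^ (3 / 2 : ℝ)) := by ring
      _ ≤ _ := by gcongr; linarith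

end SelbergScrew
end

/-! ### Transfer of the partial fractions to the zeros $\tfrac12-i\gamma$. -/

noncomputable section
namespace SelbergScrew

variable {F G : ℂ → ℂ} {D : GammaData}

theorem exists_xi_ne_zero (hF : SemiExtendedSelbergClass F) (hG : EntireExtension F G) :
    ∃ s, xi F D s ≠ 0 :=
  ⟨2, xi_ne_zero_of_one_lt_re hF hG (by simp)⟩

/-- `f` is `ξ_F(1/2 + w)` with its zero at `w = 0` divided out. -/
structure ShiftedXi (F : ℂ → ℂ) (D : GammaData) (f : ℂ → ℂ) (B : ℝ) : Prop extends
    GenusOne f B where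
  eq : ∀ w, xi F D (1 / 2 + w) = w ^ mult F D 0 * f w
  xi_diff : Differentiable ℂ (xi F D)
  xi_ne : ∃ s, xi F D s ≠ 0
  re_mem : ∀ s, xi F D s = 0 → 0 ≤ s.re ∧ s.re ≤ 1

/-- Dividing by $w^{m_0}$ does not spoil the growth bound: for $|w|\ge1$ it only decreases the
modulus, and for $|w|\le1$ compactness applies. The normalisation by $|f(0)|$ is absorbed into the
constant in the exponent. -/
theorem exists_shiftedXi (hF : SemiExtendedSelbergClass F) (hG : EntireExtension F G)
    (hD : FunctionalEquation F D) : ∃ f B, ShiftedXi F D f B := by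
  have hdiff := differentiable_xi hG hD
  have hne := exists_xi_ne_zero (D := D) hF hG
  obtain ⟨g, hg, hg0, hxg⟩ := exists_eq_pow_order_mul hdiff hne (1 / 2)
  obtain ⟨K, B, hK, hB, hxi⟩ := exists_xi_le hF.toExtendedSelbergClass hG hD
  let f : ℂ → ℂ := fun w => g (1 / 2 + w)
  have hf : Differentiable ℂ f := by fun_prop
  have hf0 : f 0 ≠ 0 := by simpa [f] using hg0
  have heq : ∀ w, xi F D (1 / 2 + w) = w ^ mult F D 0 * f w := by
    intro w
    rw [hxg, mult, mul_zero, sub_zero]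
    congr 2
    ring
  obtain ⟨M, hM⟩ := (isCompact_closedBall (0 : ℂ) 1).exists_bound_of_continuousOn
    hf.continuous.continuousOn
  have hf0' : 0 < ‖f 0‖ := norm_pos_iff.2 hf0
  let A : ℝ := K + |M|
  have hbound : ∀ w, ‖f w‖ ≤ A * Real.exp (B * 2 ^ (3 / 2 : ℝ) * (1 + ‖w‖) ^ (3 / 2 : ℝ)) := by
    intro w
    rcases le_total ‖w‖ 1 with hw | hw
    · have h1 := hM w (by simpa using hw)
      have h2 : (1 : ℝ) ≤ Real.exp (B * 2 ^ (3 / 2 : ℝ) * (1 + ‖w‖) ^ (3 / 2 : ℝ)) :=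
        Real.one_le_exp (by positivity)
      calc ‖f w‖ ≤ A * 1 := by simp only [A]; linarith [le_abs_self M]
        _ ≤ _ := by gcongr
    · have h1 := hxi (1 / 2 + w)
      rw [heq, norm_mul, norm_pow] at h1
      have h2 : ‖f w‖ ≤ ‖w‖ ^ mult F D 0 * ‖f w‖ :=
        le_mul_of_one_le_left (norm_nonneg _) (one_le_pow₀ hw)
      refine h2.trans (h1.trans ?_)
      have h3 : ‖1 / 2 + w‖ ≤ 1 / 2 + ‖w‖ := by
        refine (norm_add_le _ _).trans ?_
        simp
      rw [mul_assoc B, ← Real.mul_rpow (by norm_num) (by positivity)]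
      have h4 : K ≤ A := by simp only [A]; linarith [abs_nonneg M]
      gcongr
      linarith
  have hA : 0 < A := by positivity
  have h1 : A / ‖f 0‖ ≤ Real.exp (A / ‖f 0‖) := by linarith [Real.add_one_le_exp (A / ‖f 0‖)]
  have hAf : 0 < A / ‖f 0‖ := by positivity
  refine ⟨f, A / ‖f 0‖ + B * 2 ^ (3 / 2 : ℝ),
    ⟨⟨hf, hf0, by positivity, fun w => (hbound w).trans ?_⟩, heq, hdiff, hne,
    fun s hs => re_mem_Icc_of_xi_eq_zero hF hG hD hs⟩⟩
  have h5 : (1 : ℝ) ≤ (1 + ‖w‖) ^ (3 / 2 : ℝ) :=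
    Real.one_le_rpow (by linarith [norm_nonneg w]) (by norm_num)
  rw [add_mul (A / ‖f 0‖), Real.exp_add, ← mul_assoc]
  gcongr
  calc A = ‖f 0‖ * (A / ‖f 0‖) := by field_simp
    _ ≤ ‖f 0‖ * Real.exp (A / ‖f 0‖ * (1 + ‖w‖) ^ (3 / 2 : ℝ)) := by
      gcongr
      refine h1.trans (Real.exp_le_exp.2 (le_mul_of_one_le_right hAf.le h5))

namespace ShiftedXi

variable {f : ℂ → ℂ} {B : ℝ}

theorem mult_eq (h : ShiftedXi F D f B) {γ : ℂ} (hγ : γ ≠ 0) :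
    mult F D γ = analyticOrderNatAt f (-I * γ) := by
  have h1 := analyticOrderNatAt_comp_const_add h.xi_diff h.xi_ne (1 / 2) (-I * γ)
  have h2 : (1 : ℂ) / 2 - I * γ = 1 / 2 + -I * γ := by ring
  rw [mult, h2, ← h1]
  obtain ⟨g, hg, hgρ, hfg⟩ := exists_eq_pow_order_mul h.diff ⟨0, h.ne⟩ (-I * γ)
  have hρ : -I * γ ≠ 0 := mul_ne_zero (neg_ne_zero.2 I_ne_zero) hγ
  have hd : Differentiable ℂ fun w => xi F D (1 / 2 + w) :=
    h.xi_diff.comp (by fun_prop : Differentiable ℂ fun w : ℂ => 1 / 2 + w)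
  refine analyticOrderNatAt_eq_of_eq_pow_mul (g := fun w => w ^ mult F D 0 * g w) hd
    (by fun_prop) (mul_ne_zero (pow_ne_zero _ hρ) hgρ) fun z => ?_
  rw [h.eq, hfg]
  ring

theorem mem_nonzeroZeros_iff (h : ShiftedXi F D f B) (γ : ℂ) :
    γ ∈ nonzeroZeros F D ↔ f (-I * γ) = 0 := by
  have h2 : (1 : ℂ) / 2 - I * γ = 1 / 2 + -I * γ := by ring
  simp only [nonzeroZeros, Set.mem_ofPred_eq]
  rw [h2, h.eq]
  constructor
  · rintro ⟨h0, h1⟩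
    have hρ : -I * γ ≠ 0 := mul_ne_zero (neg_ne_zero.2 I_ne_zero) h0
    exact (mul_eq_zero.1 h1).resolve_left (pow_ne_zero _ hρ)
  · intro h1
    refine ⟨?_, by rw [h1, mul_zero]⟩
    rintro rfl
    rw [mul_zero] at h1
    exact h.ne h1

/-- The zeros of `f` correspond to the nonzero `γ`. -/
def zerosEquiv (h : ShiftedXi F D f B) : nonzeroZeros F D ≃ {ρ // f ρ = 0} where
  toFun γ := ⟨-I * γ, (h.mem_nonzeroZeros_iff γ).1 γ.2⟩
  invFun ρ := ⟨I * ρ, (h.mem_nonzeroZeros_iff _).2 (by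
    rw [← mul_assoc, neg_mul, I_mul_I, neg_neg, one_mul]; exact ρ.2)⟩
  left_inv γ := by
    ext
    simp [← mul_assoc]
  right_inv ρ := by
    ext
    simp [← mul_assoc]

theorem summable_mult (h : ShiftedXi F D f B) :
    Summable fun γ : nonzeroZeros F D => (mult F D γ : ℝ) / ‖(γ : ℂ)‖ ^ 2 := by
  refine (h.zerosEquiv.summable_iff.2 h.summable_order).congr fun γ => ?_
  rw [h.mult_eq γ.2.1]
  simp [zerosEquiv]

theorem abs_im_le (h : ShiftedXi F D f B) (γ : nonzeroZeros F D) :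
    -(1 / 2) ≤ (I * (γ : ℂ)).re ∧ (I * (γ : ℂ)).re ≤ 1 / 2 := by
  have h1 := h.re_mem _ γ.2.2
  simp only [sub_re] at h1
  norm_num at h1 ⊢
  constructor <;> linarith

/-- Removing the factor $w^{m_0}$ removes exactly the polar part $m_0/(s-\tfrac12)$, so the constant
term is the logarithmic derivative of the cofactor. -/
theorem tendsto_iB (h : ShiftedXi F D f B) :
    Tendsto (xiLogDerivReg F D) (𝓝[≠] (1 / 2 : ℂ)) (𝓝 (logDeriv f 0)) := by
  have h1 := tendsto_logDeriv_sub (f := xi F D) (g := fun z => f (z - 1 / 2)) (ρ := 1 / 2)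
    (k := mult F D 0) (h.diff.comp (by fun_prop : Differentiable ℂ fun z : ℂ => z - 1 / 2))
    (by simpa using h.ne) (fun z => by rw [← h.eq]; congr 1; ring)
  have h2 : logDeriv (fun z => f (z - 1 / 2)) (1 / 2) = logDeriv f 0 := by
    rw [logDeriv_apply, logDeriv_apply, deriv_comp_sub_const]
    simp
  rw [h2] at h1
  exact h1

theorem iB_eq (h : ShiftedXi F D f B) : iB F D = logDeriv f 0 := h.tendsto_iB.limUnder_eq

/-- The partial fraction expansion at $\rho=-i\gamma$ with its sign reversed, so that the summands
are the transforms of `expKernel` at $\beta=i\gamma$ up to $w^{-2}$. The half-plane $\Re w>\tfrac12$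
lies to the right of all zeros. -/
theorem hasSum_zeros (h : ShiftedXi F D f B) {w : ℂ} (hw : 1 / 2 < w.re) :
    HasSum (fun γ : nonzeroZeros F D => (mult F D γ : ℂ) * (1 / (I * γ) - 1 / (w + I * γ)))
      (iB F D + mult F D 0 / w - logDeriv (xi F D) (w + 1 / 2)) := by
  have hw0 : w ≠ 0 := by
    rintro rfl
    norm_num at hw
  have hfw : f w ≠ 0 := by
    intro h0
    have h1 := (h.re_mem (1 / 2 + w) (by rw [h.eq, h0, mul_zero])).2
    norm_num at h1
    linarith
  have h1 := (h.zerosEquiv.hasSum_iff.2 (h.hasSum_logDeriv hfw)).neg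
  have h2 : logDeriv (xi F D) (w + 1 / 2) = mult F D 0 / w + logDeriv f w := by
    have h3 := logDeriv_pow_mul (f := fun w => xi F D (1 / 2 + w)) (ρ := 0) (k := mult F D 0) h.diff
      (fun z => by rw [sub_zero]; exact h.eq z) hw0 hfw
    rw [sub_zero] at h3
    rw [← h3, logDeriv_apply, logDeriv_apply, deriv_comp_const_add, add_comm]
  rw [h2, h.iB_eq]
  convert! h1 using 1
  · funext γ
    have hγ : (γ : ℂ) ≠ 0 := γ.2.1
    simp only [Function.comp_apply, zerosEquiv, Equiv.coe_fn_mk]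
    rw [h.mult_eq hγ]
    have h5 : w - -I * γ = w + I * γ := by ring
    have h6 : -I * (γ : ℂ) = -(I * γ) := by ring
    rw [h5, h6, one_div (-(I * (γ : ℂ))), inv_neg]
    ring
  · ring

end ShiftedXi

end SelbergScrew
end

/-! ### Laplace transforms: calculus, uniqueness and building blocks. -/

noncomputable section
namespace SelbergScrew

open MeasureTheory Set
open scoped FourierTransform

/-- `h` is continuous on `[0, ∞)`, of exponential growth of every rate `σ > 1/2`, with Laplace
transform `Λ` on `Re w > 1/2`. -/
structure HasLaplace (h : ℝ → ℂ) (Λ : ℂ → ℂ) : Prop where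
  cont : ContinuousOn h (Ici 0)
  growth : ∀ σ : ℝ, 1 / 2 < σ → ∃ C : ℝ, ∀ t : ℝ, 0 ≤ t → ‖h t‖ ≤ C * Real.exp (σ * t)
  eq : ∀ w : ℂ, 1 / 2 < w.re → ∫ t in Ioi (0 : ℝ), exp (-w * t) * h t = Λ w

theorem norm_exp_neg_mul (w : ℂ) (t : ℝ) : ‖exp (-w * t)‖ = Real.exp (-w.re * t) := by
  rw [norm_exp]
  simp

theorem norm_exp_neg_mul_mul_le {h : ℝ → ℂ} {C σ : ℝ} {t : ℝ} (ht : ‖h t‖ ≤ C * Real.exp (σ * t))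
    (w : ℂ) : ‖exp (-w * t) * h t‖ ≤ C * Real.exp (-(w.re - σ) * t) := by
  rw [norm_mul, norm_exp_neg_mul]
  calc Real.exp (-w.re * t) * ‖h t‖ ≤ Real.exp (-w.re * t) * (C * Real.exp (σ * t)) := by gcongr
    _ = C * (Real.exp (-w.re * t) * Real.exp (σ * t)) := by ring
    _ = _ := by rw [← Real.exp_add]; ring_nf

theorem integrableOn_of_growth {h : ℝ → ℂ} {C σ : ℝ} (hc : ContinuousOn h (Ici 0))
    (hg : ∀ t : ℝ, 0 ≤ t → ‖h t‖ ≤ C * Real.exp (σ * t)) {w : ℂ} (hw : σ < w.re) :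
    IntegrableOn (fun t : ℝ => exp (-w * t) * h t) (Ioi 0) := by
  have h1 : IntegrableOn (fun t : ℝ => C * Real.exp (-(w.re - σ) * t)) (Ioi 0) :=
    (exp_neg_integrableOn_Ioi 0 (by linarith)).const_mul C
  refine Integrable.mono' h1 ?_ ?_
  · refine ContinuousOn.aestronglyMeasurable ?_ measurableSet_Ioi
    exact ContinuousOn.mul (by fun_prop) (hc.mono Ioi_subset_Ici_self)
  · refine (ae_restrict_iff' measurableSet_Ioi).2 (Eventually.of_forall fun t ht => ?_)
    exact norm_exp_neg_mul_mul_le (hg t (le_of_lt ht)) w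

namespace HasLaplace

variable {h h' : ℝ → ℂ} {Λ Λ' : ℂ → ℂ}

theorem integrableOn (hl : HasLaplace h Λ) {w : ℂ} (hw : 1 / 2 < w.re) :
    IntegrableOn (fun t : ℝ => exp (-w * t) * h t) (Ioi 0) := by
  obtain ⟨σ, hσ, hσw⟩ := exists_between hw
  obtain ⟨C, hC⟩ := hl.growth σ hσ
  exact integrableOn_of_growth hl.cont hC hσw

theorem add (hl : HasLaplace h Λ) (hl' : HasLaplace h' Λ') :
    HasLaplace (fun t => h t + h' t) (fun w => Λ w + Λ' w) where
  cont := hl.cont.add hl'.cont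
  growth σ hσ := by
    obtain ⟨C, hC⟩ := hl.growth σ hσ
    obtain ⟨C', hC'⟩ := hl'.growth σ hσ
    refine ⟨C + C', fun t ht => (norm_add_le _ _).trans ?_⟩
    rw [add_mul]
    exact add_le_add (hC t ht) (hC' t ht)
  eq w hw := by
    rw [← hl.eq w hw, ← hl'.eq w hw, ← integral_add (hl.integrableOn hw) (hl'.integrableOn hw)]
    simp only [mul_add]

theorem const_mul (hl : HasLaplace h Λ) (a : ℂ) :
    HasLaplace (fun t => a * h t) (fun w => a * Λ w) where
  cont := continuousOn_const.mul hl.cont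
  growth σ hσ := by
    obtain ⟨C, hC⟩ := hl.growth σ hσ
    refine ⟨‖a‖ * C, fun t ht => ?_⟩
    rw [norm_mul, mul_assoc]
    exact mul_le_mul_of_nonneg_left (hC t ht) (norm_nonneg a)
  eq w hw := by
    rw [← hl.eq w hw, ← integral_const_mul]
    simp only [mul_left_comm]

theorem congr (hl : HasLaplace h Λ) (hh : ∀ t, 0 ≤ t → h' t = h t)
    (hΛ : ∀ w : ℂ, 1 / 2 < w.re → Λ' w = Λ w) : HasLaplace h' Λ' where
  cont := hl.cont.congr hh
  growth σ hσ := by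
    obtain ⟨C, hC⟩ := hl.growth σ hσ
    exact ⟨C, fun t ht => by rw [hh t ht]; exact hC t ht⟩
  eq w hw := by
    rw [hΛ w hw, ← hl.eq w hw]
    refine setIntegral_congr_fun measurableSet_Ioi fun t ht => ?_
    simp only [hh t (le_of_lt ht)]

theorem zero : HasLaplace (fun _ => 0) (fun _ => 0) where
  cont := continuousOn_const
  growth σ _ := ⟨0, fun t _ => by simp⟩
  eq w _ := by simp

theorem sum {ι : Type*} (s : Finset ι) {h : ι → ℝ → ℂ} {Λ : ι → ℂ → ℂ}
    (hl : ∀ i, HasLaplace (h i) (Λ i)) :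
    HasLaplace (fun t => ∑ i ∈ s, h i t) (fun w => ∑ i ∈ s, Λ i w) := by
  classical
  induction s using Finset.induction_on with
  | empty => simpa using HasLaplace.zero
  | insert i s hi ih =>
    simp only [Finset.sum_insert hi]
    exact (hl i).add ih

/-- The summable majorants $b_ie^{\sigma t}$ serve twice: as a Weierstrass bound on each $[0,T]$ for
continuity, and to exchange sum and integral once $\sigma<\Re w$. -/
theorem tsum {ι : Type*} [Countable ι] {h : ι → ℝ → ℂ} {Λ : ι → ℂ → ℂ}
    (hl : ∀ i, HasLaplace (h i) (Λ i))
    (hb : ∀ σ : ℝ, 1 / 2 < σ → ∃ b : ι → ℝ, Summable b ∧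
      ∀ i, ∀ t : ℝ, 0 ≤ t → ‖h i t‖ ≤ b i * Real.exp (σ * t)) :
    HasLaplace (fun t => ∑' i, h i t) (fun w => ∑' i, Λ i w) := by
  have hg : ∀ σ : ℝ, 1 / 2 < σ → ∃ C : ℝ, ∀ t : ℝ, 0 ≤ t →
      ‖∑' i, h i t‖ ≤ C * Real.exp (σ * t) := by
    intro σ hσ
    obtain ⟨b, hbs, hbb⟩ := hb σ hσ
    refine ⟨∑' i, b i, fun t ht => ?_⟩
    rw [← tsum_mul_right]
    exact tsum_of_norm_bounded (hbs.mul_right _).hasSum fun i => hbb i t ht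
  have hc : ContinuousOn (fun t => ∑' i, h i t) (Ici 0) := by
    obtain ⟨b, hbs, hbb⟩ := hb 1 (by norm_num)
    have h1 : ∀ T : ℝ, ContinuousOn (fun t => ∑' i, h i t) (Icc 0 T) := by
      intro T
      refine continuousOn_tsum (u := fun i => b i * Real.exp T)
        (fun i => (hl i).cont.mono Icc_subset_Ici_self) (hbs.mul_right _) fun i t ht => ?_
      have hb0 : 0 ≤ b i := by
        have := (norm_nonneg _).trans (hbb i 0 le_rfl)
        simpa using this
      refine (hbb i t ht.1).trans ?_
      gcongr
      linarith [ht.2]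
    intro t ht
    refine (h1 (t + 1) t ⟨ht, by linarith⟩).mono_of_mem_nhdsWithin ?_
    rw [← Ici_inter_Iic]
    exact inter_mem self_mem_nhdsWithin (nhdsWithin_le_nhds (Iic_mem_nhds (by linarith)))
  refine ⟨hc, hg, fun w hw => ?_⟩
  obtain ⟨σ, hσ, hσw⟩ := exists_between hw
  obtain ⟨b, hbs, hbb⟩ := hb σ hσ
  have h2 : IntegrableOn (fun t : ℝ => Real.exp (-(w.re - σ) * t)) (Ioi 0) :=
    exp_neg_integrableOn_Ioi 0 (by linarith)
  have h3 := hasSum_integral_of_summable_integral_norm (μ := volume.restrict (Ioi (0 : ℝ)))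
    (F := fun i (t : ℝ) => exp (-w * t) * h i t) (fun i => (hl i).integrableOn hw) (by
      refine (hbs.mul_right (∫ t in Ioi (0 : ℝ), Real.exp (-(w.re - σ) * t))).of_nonneg_of_le
        (fun i => integral_nonneg fun t => norm_nonneg _) fun i => ?_
      rw [← integral_const_mul]
      refine setIntegral_mono_on ((hl i).integrableOn hw).norm (h2.const_mul _)
        measurableSet_Ioi fun t ht => ?_
      exact norm_exp_neg_mul_mul_le (hbb i t (le_of_lt ht)) w)
  have h4 : (fun i => ∫ t in Ioi (0 : ℝ), exp (-w * t) * h i t) = fun i => Λ i w :=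
    funext fun i => (hl i).eq w hw
  rw [h4] at h3
  rw [h3.tsum_eq]
  simp only [tsum_mul_left]

/-- A continuous function with vanishing Laplace transform vanishes. -/
theorem eq_zero (hl : HasLaplace h Λ) (hΛ : ∀ w : ℂ, 1 / 2 < w.re → Λ w = 0) (h0 : h 0 = 0)
    {t : ℝ} (ht : 0 ≤ t) : h t = 0 := by
  -- The Laplace transform on the line $\Re w=1$ is the Fourier transform of $e^{-t}h(t)$ extended
  -- by zero. The extension is continuous because $h(0)=0$, so Fourier inversion holds pointwise and
  -- a vanishing transform forces $u=0$.
  let u : ℝ → ℂ := indicator (Ioi 0) fun t : ℝ => exp (-1 * (t : ℂ)) * h t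
  have hu : ∀ t, 0 ≤ t → u t = exp (-1 * (t : ℂ)) * h t := by
    intro t ht
    rcases ht.eq_or_lt with rfl | ht
    · simp [u, h0]
    · simp only [u]
      rw [indicator_of_mem (mem_Ioi.2 ht)]
  have hint : Integrable u :=
    (integrable_indicator_iff measurableSet_Ioi).2 (hl.integrableOn (w := 1) (by norm_num))
  have hcont : Continuous u := by
    rw [continuous_iff_continuousAt]
    intro t
    rcases lt_or_ge t 0 with ht | ht
    · have : u =ᶠ[𝓝 t] fun _ => 0 := by
        filter_upwards [Iio_mem_nhds ht] with x hx
        simp only [u]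
        rw [indicator_of_notMem]
        exact not_lt.2 (le_of_lt (mem_Iio.1 hx))
      exact continuousAt_const.congr this.symm
    · have hr : ContinuousWithinAt u (Ici 0) t := by
        have h1 : ContinuousOn (fun t : ℝ => exp (-1 * (t : ℂ)) * h t) (Ici 0) :=
          ContinuousOn.mul (by fun_prop) hl.cont
        exact (h1 t ht).congr (fun x hx => hu x hx) (hu t ht)
      rcases ht.eq_or_lt with rfl | ht
      · have hleft : ContinuousWithinAt u (Iic 0) 0 := by
          have h2 : ∀ x ∈ Iic (0 : ℝ), u x = 0 := by
            intro x hx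
            simp only [u]
            rw [indicator_of_notMem]
            exact not_lt.2 (mem_Iic.1 hx)
          exact (continuousWithinAt_const (b := (0 : ℂ))).congr h2 (h2 0 self_mem_Iic)
        exact continuousAt_iff_continuous_left_right.2 ⟨hleft, hr⟩
      · exact hr.continuousAt (Ici_mem_nhds ht)
  have hF : 𝓕 u = 0 := by
    funext x
    have h1 : ∀ v : ℝ, exp (((-2 * Real.pi * v * x : ℝ) : ℂ) * I) • u v
        = indicator (Ioi 0) (fun t : ℝ => exp (-(1 + 2 * Real.pi * x * I) * (t : ℂ)) * h t) v := by
      intro v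
      by_cases hv : v ∈ Ioi (0 : ℝ)
      · simp only [u]
        rw [indicator_of_mem hv, indicator_of_mem hv, smul_eq_mul, ← mul_assoc, ← exp_add]
        push_cast
        ring_nf
      · simp only [u]
        rw [indicator_of_notMem hv, indicator_of_notMem hv, smul_zero]
    rw [Real.fourier_real_eq_integral_exp_smul]
    simp only [h1]
    have hre : 1 / 2 < (1 + 2 * Real.pi * x * I : ℂ).re := by
      simp
      norm_num
    rw [integral_indicator measurableSet_Ioi, hl.eq _ hre, hΛ _ hre]
    rfl
  have hF' : Integrable (𝓕 u) := by
    rw [hF]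
    exact integrable_zero _ _ _
  have hinv := hcont.fourierInv_fourier_eq hint hF'
  have hut : u t = 0 := by
    rw [← hinv, hF, Real.fourierInv_eq]
    simp
  rw [hu t ht] at hut
  exact (mul_eq_zero.1 hut).resolve_left (exp_ne_zero _)

end HasLaplace

theorem pow_le_exp_growth (n : ℕ) {σ t : ℝ} (hσ : 1 / 2 < σ) (ht : 0 ≤ t) :
    t ^ n ≤ 2 ^ n * n.factorial * Real.exp (σ * t) := by
  have h1 := pow_le_factorial_mul_exp (x := t / 2) (by positivity) n
  rw [div_pow, div_le_iff₀ (by positivity)] at h1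
  calc t ^ n ≤ n.factorial * Real.exp (t / 2) * 2 ^ n := h1
    _ ≤ n.factorial * Real.exp (σ * t) * 2 ^ n := by
      gcongr
      nlinarith
    _ = _ := by ring

theorem tendsto_exp_neg_mul_pow {w : ℂ} (hw : 1 / 2 < w.re) (n : ℕ) :
    Tendsto (fun t : ℝ => exp (-w * t) * (t : ℂ) ^ n) atTop (𝓝 0) := by
  obtain ⟨σ, hσ, hσw⟩ := exists_between hw
  have h1 : Tendsto (fun t : ℝ => (2 ^ n * n.factorial) * Real.exp (-(w.re - σ) * t)) atTop
      (𝓝 0) := by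
    rw [← mul_zero ((2 : ℝ) ^ n * n.factorial)]
    refine Tendsto.const_mul _ (Real.tendsto_exp_atBot.comp ?_)
    exact tendsto_id.const_mul_atTop_of_neg (by linarith)
  refine squeeze_zero_norm' ?_ h1
  filter_upwards [eventually_ge_atTop 0] with t ht
  refine norm_exp_neg_mul_mul_le (h := fun t : ℝ => (t : ℂ) ^ n) ?_ w
  rw [norm_pow, norm_real, Real.norm_eq_abs, abs_of_nonneg ht]
  exact pow_le_exp_growth n hσ ht

theorem hasDerivAt_exp_neg_mul (w : ℂ) (t : ℝ) :
    HasDerivAt (fun t : ℝ => exp (-w * t)) (-w * exp (-w * t)) t := by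
  have h1 : HasDerivAt (fun t : ℝ => -w * (t : ℂ)) (-w) t := by
    simpa using (ofRealCLM.hasDerivAt (x := t)).const_mul (-w)
  simpa [mul_comm] using h1.cexp

theorem hasLaplace_ofReal : HasLaplace (fun t => (t : ℂ)) fun w => 1 / w ^ 2 where
  cont := by fun_prop
  growth σ hσ := ⟨2, fun t ht => by
    have := pow_le_exp_growth 1 hσ ht
    simpa [abs_of_nonneg ht] using this⟩
  eq w hw := by
    have hw0 : w ≠ 0 := by rintro rfl; norm_num at hw
    have hint : IntegrableOn (fun t : ℝ => exp (-w * t) * (t : ℂ)) (Ioi 0) := by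
      refine integrableOn_of_growth (C := 2) (σ := (1 / 2 + w.re) / 2) (by fun_prop)
        (fun t ht => ?_) (by linarith)
      have := pow_le_exp_growth 1 (σ := (1 / 2 + w.re) / 2) (by linarith) ht
      simpa [abs_of_nonneg ht] using this
    have h1 := integral_Ioi_of_hasDerivAt_of_tendsto (a := 0)
      (f := fun t : ℝ => -(exp (-w * t) * (t : ℂ) ^ 1 / w + exp (-w * t) * (t : ℂ) ^ 0 / w ^ 2))
      (m := -(0 / w + 0 / w ^ 2))
      (Continuous.continuousWithinAt (by fun_prop)) (fun t _ => by
        have h2 := hasDerivAt_exp_neg_mul w t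
        have h3 : HasDerivAt (fun t : ℝ => (t : ℂ)) 1 t := ofRealCLM.hasDerivAt
        have h4 := (((h2.mul h3).div_const w).add (h2.div_const (w ^ 2))).neg
        refine (h4.congr_deriv (f' := _) (g' := exp (-w * t) * (t : ℂ)) ?_).congr_of_eventuallyEq
          (Eventually.of_forall fun s => ?_)
        · field_simp
          ring
        · simp) hint
      (((tendsto_exp_neg_mul_pow hw 1).div_const w).add
        ((tendsto_exp_neg_mul_pow hw 0).div_const (w ^ 2))).neg
    rw [h1]
    simp

theorem hasLaplace_sq : HasLaplace (fun t => (t : ℂ) ^ 2) fun w => 2 / w ^ 3 where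
  cont := by fun_prop
  growth σ hσ := ⟨2 ^ 2 * (2).factorial, fun t ht => by
    have := pow_le_exp_growth 2 hσ ht
    simpa using this⟩
  eq w hw := by
    have hw0 : w ≠ 0 := by rintro rfl; norm_num at hw
    have hint : IntegrableOn (fun t : ℝ => exp (-w * t) * (t : ℂ) ^ 2) (Ioi 0) := by
      refine integrableOn_of_growth (C := 2 ^ 2 * (2).factorial) (σ := (1 / 2 + w.re) / 2)
        (by fun_prop) (fun t ht => ?_) (by linarith)
      have := pow_le_exp_growth 2 (σ := (1 / 2 + w.re) / 2) (by linarith) ht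
      simpa using this
    have h1 := integral_Ioi_of_hasDerivAt_of_tendsto (a := 0)
      (f := fun t : ℝ => -(exp (-w * t) * (t : ℂ) ^ 2 / w + 2 * (exp (-w * t) * (t : ℂ) ^ 1 / w ^ 2)
        + 2 * (exp (-w * t) * (t : ℂ) ^ 0 / w ^ 3)))
      (m := -(0 / w + 2 * (0 / w ^ 2) + 2 * (0 / w ^ 3)))
      (Continuous.continuousWithinAt (by fun_prop)) (fun t _ => by
        have h2 := hasDerivAt_exp_neg_mul w t
        have h3 : HasDerivAt (fun t : ℝ => (t : ℂ)) 1 t := ofRealCLM.hasDerivAt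
        have h4 := ((((h2.mul (h3.pow 2)).div_const w).add
          (((h2.mul h3).div_const (w ^ 2)).const_mul 2)).add
          ((h2.div_const (w ^ 3)).const_mul 2)).neg
        refine (h4.congr_deriv (f' := _) (g' := exp (-w * t) * (t : ℂ) ^ 2) ?_).congr_of_eventuallyEq
          (Eventually.of_forall fun s => ?_)
        · field_simp
          simp
          ring
        · simp) hint
      ((((tendsto_exp_neg_mul_pow hw 2).div_const w).add
        (((tendsto_exp_neg_mul_pow hw 1).div_const (w ^ 2)).const_mul 2)).add
        (((tendsto_exp_neg_mul_pow hw 0).div_const (w ^ 3)).const_mul 2)).neg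
    rw [h1]
    simp
    ring

/-- A ramp started at $L$. With $L=\log n$, it turns the cutoff $n\le e^t$ into a series over all
$n$ with continuous terms. -/
theorem hasLaplace_max {L : ℝ} (hL : 0 ≤ L) :
    HasLaplace (fun t => ((max (t - L) 0 : ℝ) : ℂ)) fun w => exp (-w * L) / w ^ 2 where
  cont := by fun_prop
  growth σ hσ := ⟨2, fun t ht => by
    have := pow_le_exp_growth 1 hσ ht
    rw [norm_real, Real.norm_eq_abs, abs_of_nonneg (le_max_right _ _)]
    refine (max_le (by linarith) ht : max (t - L) 0 ≤ t).trans ?_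
    simpa using this⟩
  eq w hw := by
    have hw0 : w ≠ 0 := by rintro rfl; norm_num at hw
    have hshift : ∫ t in Ioi (0 : ℝ), exp (-w * t) * ((max (t - L) 0 : ℝ) : ℂ)
        = ∫ t in Ioi L, exp (-w * t) * ((max (t - L) 0 : ℝ) : ℂ) := by
      refine setIntegral_eq_of_subset_of_forall_sdiff_eq_zero measurableSet_Ioi
        (Ioi_subset_Ioi hL) fun t ht => ?_
      have : t ≤ L := not_lt.1 ht.2
      rw [max_eq_right (by linarith)]
      simp
    have hsub : ∫ t in Ioi L, exp (-w * t) * ((max (t - L) 0 : ℝ) : ℂ)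
        = ∫ t in Ioi (0 : ℝ), exp (-w * L) * (exp (-w * t) * (t : ℂ)) := by
      rw [← integral_indicator measurableSet_Ioi, ← integral_indicator measurableSet_Ioi,
        ← integral_add_right_eq_self _ L]
      congr 1
      funext t
      by_cases ht : 0 < t
      · rw [indicator_of_mem (show t + L ∈ Ioi L by simpa using ht), indicator_of_mem (mem_Ioi.2 ht),
          add_sub_cancel_right, max_eq_left ht.le, ← mul_assoc, ← exp_add]
        push_cast
        ring_nf
      · rw [indicator_of_notMem (show t + L ∉ Ioi L by simpa using ht),
          indicator_of_notMem (by simpa using ht)]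
    rw [hshift, hsub, integral_const_mul, hasLaplace_ofReal.eq w hw]
    ring

/-- The function `(1 - e^{-βt}) / β²`. -/
def expKernel (β : ℂ) (t : ℝ) : ℂ := (1 - exp (-β * t)) / β ^ 2

theorem norm_expKernel_le {β : ℂ} (hβ : -(1 / 2) ≤ β.re) {σ t : ℝ} (hσ : 1 / 2 < σ) (ht : 0 ≤ t) :
    ‖expKernel β t‖ ≤ 2 / ‖β‖ ^ 2 * Real.exp (σ * t) := by
  rw [expKernel, norm_div, norm_pow, div_mul_eq_mul_div]
  gcongr
  refine (norm_sub_le _ _).trans ?_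
  rw [norm_one, norm_exp_neg_mul]
  have h1 : (1 : ℝ) ≤ Real.exp (σ * t) := Real.one_le_exp (by positivity)
  have h2 : Real.exp (-β.re * t) ≤ Real.exp (σ * t) := by
    gcongr
    linarith
  linarith

/-- The condition $\Re\beta\ge-\tfrac12$ is what zeros in the strip $0\le\Re s\le1$ supply, and it
is attained by $\beta=-\tfrac12$ from the factor $(s-1)^{m_F}$. -/
theorem hasLaplace_expKernel {β : ℂ} (hβ0 : β ≠ 0) (hβ : -(1 / 2) ≤ β.re) :
    HasLaplace (expKernel β) fun w => (1 / β - 1 / (w + β)) / w ^ 2 where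
  cont := by unfold expKernel; fun_prop
  growth σ hσ := ⟨2 / ‖β‖ ^ 2, fun t ht => norm_expKernel_le hβ hσ ht⟩
  eq w hw := by
    have hw0 : w ≠ 0 := by rintro rfl; norm_num at hw
    have hwβ : w + β ≠ 0 := by
      intro h
      have := congrArg re h
      simp at this
      linarith
    have e1 : (-w).re < 0 := by simp; linarith
    have e2 : (-(w + β)).re < 0 := by simp; linarith
    have h1 : ∀ t : ℝ, exp (-w * t) * expKernel β t
        = (exp (-w * t) - exp (-(w + β) * t)) / β ^ 2 := by
      intro t
      rw [expKernel, mul_div_assoc', mul_sub, mul_one, ← exp_add]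
      ring_nf
    simp only [h1]
    rw [integral_div, integral_sub (integrableOn_exp_mul_complex_Ioi e1 0)
      (integrableOn_exp_mul_complex_Ioi e2 0), integral_exp_mul_complex_Ioi e1,
      integral_exp_mul_complex_Ioi e2]
    simp only [ofReal_zero, mul_zero, exp_zero]
    field_simp
    ring

theorem hasLaplace_tsum_expKernel {ι : Type*} [Countable ι] {m β : ι → ℂ} (hβ0 : ∀ i, β i ≠ 0)
    (hβ : ∀ i, -(1 / 2) ≤ (β i).re) (hs : Summable fun i => ‖m i‖ / ‖β i‖ ^ 2) :
    HasLaplace (fun t => ∑' i, m i * expKernel (β i) t)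
      fun w => (∑' i, m i * (1 / β i - 1 / (w + β i))) / w ^ 2 := by
  have h1 := HasLaplace.tsum (fun i => (hasLaplace_expKernel (hβ0 i) (hβ i)).const_mul (m i))
    (fun σ hσ => ⟨fun i => 2 * (‖m i‖ / ‖β i‖ ^ 2), hs.mul_left 2, fun i t ht => by
      rw [norm_mul]
      refine (mul_le_mul_of_nonneg_left (norm_expKernel_le (hβ i) hσ ht) (norm_nonneg _)).trans
        (le_of_eq ?_)
      ring⟩)
  refine h1.congr (fun t _ => rfl) fun w _ => ?_
  rw [← tsum_div_const]
  refine tsum_congr fun i => ?_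
  ring

theorem summable_expKernel {ι : Type*} {m β : ι → ℂ}
    (hβ : ∀ i, -(1 / 2) ≤ (β i).re) (hs : Summable fun i => ‖m i‖ / ‖β i‖ ^ 2) {t : ℝ}
    (ht : 0 ≤ t) : Summable fun i => m i * expKernel (β i) t := by
  refine (hs.mul_left (2 * Real.exp (1 * t))).of_norm_bounded fun i => ?_
  rw [norm_mul]
  refine (mul_le_mul_of_nonneg_left (norm_expKernel_le (hβ i) (by norm_num : (1 : ℝ) / 2 < 1) ht)
    (norm_nonneg _)).trans (le_of_eq ?_)
  ring

end SelbergScrew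
end

/-! ### Laplace transforms of the screw function and of $\Phi_F$. -/

noncomputable section
namespace SelbergScrew

variable {F G : ℂ → ℂ} {D : GammaData}

namespace ShiftedXi

variable {f : ℂ → ℂ} {B : ℝ}

/-- A summable family has countable support, and every zero has positive multiplicity. Countability
is needed to exchange sum and integral. -/
theorem countable (h : ShiftedXi F D f B) : Countable (nonzeroZeros F D) := by
  have h1 := h.summable_mult.countable_support
  rw [← Set.countable_univ_iff]
  refine h1.mono fun γ _ => ?_
  have h2 : 1 ≤ mult F D γ := by
    rw [h.mult_eq γ.2.1]
    exact h.one_le_order ((h.mem_nonzeroZeros_iff γ).1 γ.2)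
  have h3 : 0 < ‖(γ : ℂ)‖ := norm_pos_iff.2 γ.2.1
  have h4 : (0 : ℝ) < mult F D γ := by exact_mod_cast h2
  rw [Function.mem_support]
  positivity

theorem zeroTerm_eq (t : ℝ) (γ : ℂ) :
    zeroTerm F D t γ = mult F D γ * expKernel (I * γ) t := by
  rw [zeroTerm, expKernel, mul_pow, I_sq]
  have : -I * γ * (t : ℂ) = -(I * γ) * t := by ring
  rw [this, neg_one_mul, div_neg, ← neg_div, neg_sub]

theorem summable_norm_mult (h : ShiftedXi F D f B) :
    Summable fun γ : nonzeroZeros F D => ‖(mult F D γ : ℂ)‖ / ‖I * (γ : ℂ)‖ ^ 2 := by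
  simpa using h.summable_mult

theorem summable_zeroTerm (h : ShiftedXi F D f B) (t : ℝ) :
    Summable fun γ : nonzeroZeros F D => zeroTerm F D t γ := by
  rcases le_total 0 t with ht | ht
  · simp only [zeroTerm_eq]
    exact summable_expKernel (fun γ => (h.abs_im_le γ).1) h.summable_norm_mult ht
  -- Negative $t$ amounts to replacing $\beta$ by $-\beta$; the critical strip is symmetric, so the
  -- same bound applies.
  · have h1 : ∀ γ : nonzeroZeros F D, zeroTerm F D t γ
        = mult F D γ * expKernel (-(I * γ)) (-t) := by
      intro γ
      rw [zeroTerm_eq, expKernel, expKernel]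
      simp
    simp only [h1]
    exact summable_expKernel (fun γ => by rw [neg_re]; linarith [(h.abs_im_le γ).2])
      (by simpa using h.summable_mult) (by linarith)

theorem hasLaplace_screwFormula (h : ShiftedXi F D f B) :
    HasLaplace (screwFormula F D) fun w => -(logDeriv (xi F D) (w + 1 / 2) / w ^ 2) := by
  have := h.countable
  have h1 := (hasLaplace_ofReal.const_mul (-iB F D)).add
    ((hasLaplace_sq.const_mul (-(mult F D 0 / 2))).add
    (hasLaplace_tsum_expKernel (m := fun γ : nonzeroZeros F D => (mult F D γ : ℂ))
      (β := fun γ => I * γ) (fun γ => mul_ne_zero I_ne_zero γ.2.1)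
      (fun γ => (h.abs_im_le γ).1) h.summable_norm_mult))
  refine h1.congr (fun t _ => ?_) fun w hw => ?_
  · simp only [screwFormula, zeroTerm_eq]
    ring
  · have hw0 : w ≠ 0 := by rintro rfl; norm_num at hw
    rw [(h.hasSum_zeros hw).tsum_eq]
    field_simp
    ring

end ShiftedXi

theorem screwFormula_zero : screwFormula F D 0 = 0 := by
  simp [screwFormula, zeroTerm]

theorem phiFormula_zero (c : ℕ → ℂ) : phiFormula F D c 0 = 0 := by
  simp [phiFormula]
  norm_num

theorem lerchTerm_two_eq {a : ℂ} (z : ℂ) (n : ℕ) :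
    lerchTerm z 2 a n = z ^ n / ((n : ℂ) + a) ^ 2 := by
  rw [lerchTerm, cpow_neg, cpow_ofNat, div_eq_mul_inv]

theorem summable_lerchTerm {a : ℂ} (ha : 0 < a.re) {z : ℂ} (hz : ‖z‖ ≤ 1) :
    Summable (lerchTerm z 2 a) := by
  refine (summable_inv_norm_sq ha).of_norm_bounded fun n => ?_
  rw [lerchTerm_two_eq, norm_div, norm_pow, norm_pow]
  gcongr
  exact pow_le_one₀ (norm_nonneg z) hz

theorem norm_exp_neg_div_le {t lam : ℝ} (ht : 0 ≤ t) (hlam : 0 < lam) :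
    ‖exp (-(t : ℂ) / lam)‖ ≤ 1 := by
  rw [norm_exp, ← ofReal_neg, ← ofReal_div, ofReal_re]
  refine Real.exp_le_one_iff.2 ?_
  rw [neg_div]
  have : 0 ≤ t / lam := by positivity
  linarith

theorem re_half_add_pos {lam : ℝ} {mu : ℂ} (hlam : 0 < lam) (hmu : 0 ≤ mu.re) :
    0 < ((lam : ℂ) / 2 + mu).re := by
  have : ((lam : ℂ) / 2 + mu).re = lam / 2 + mu.re := by simp
  rw [this]
  positivity

/-- With $a=\lambda/2+\mu$, the prefactor and the powers combine to $e^{-t(n+a)/\lambda}$, so the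
difference of Lerch series is a sum of kernels with $\beta_n=(n+a)/\lambda$. -/
theorem lerch_sub_eq_tsum {lam t : ℝ} {mu : ℂ} (hlam : 0 < lam) (hmu : 0 ≤ mu.re) (ht : 0 ≤ t) :
    (lam : ℂ) ^ 2 * (lerch 1 2 (lam / 2 + mu)
        - exp (-t * (1 / 2 + mu / lam)) * lerch (exp (-t / lam)) 2 (lam / 2 + mu))
      = ∑' n : ℕ, (1 : ℂ) * expKernel (((n : ℂ) + (lam / 2 + mu)) / lam) t := by
  have ha := re_half_add_pos hlam hmu
  have hl : (lam : ℂ) ≠ 0 := ofReal_ne_zero.2 hlam.ne'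
  have s1 := summable_lerchTerm ha (z := 1) (by simp)
  have s2 := summable_lerchTerm ha (norm_exp_neg_div_le ht hlam)
  rw [lerch, lerch, ← tsum_mul_left, ← s1.tsum_sub (s2.mul_left _), ← tsum_mul_left]
  refine tsum_congr fun n => ?_
  have hn := natCast_add_ne_zero ha n
  have he : exp (-t * (1 / 2 + mu / lam)) * exp (-t / lam) ^ n
      = exp (-(((n : ℂ) + (lam / 2 + mu)) / lam) * t) := by
    rw [← exp_nat_mul, ← exp_add]
    congr 1
    field_simp
    ring
  rw [lerchTerm_two_eq, lerchTerm_two_eq, one_pow, one_mul, expKernel, ← he]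
  field_simp

/-- Termwise transforms of the kernels add up to the series for a difference of digamma values. The
subtracted constant is cancelled by the linear term of $\Phi_F$. -/
theorem hasLaplace_lerch {lam : ℝ} {mu : ℂ} (hlam : 0 < lam) (hmu : 0 ≤ mu.re) :
    HasLaplace (fun t => (lam : ℂ) ^ 2 * (lerch 1 2 (lam / 2 + mu)
        - exp (-t * (1 / 2 + mu / lam)) * lerch (exp (-t / lam)) 2 (lam / 2 + mu)))
      fun w => lam * (digamma (lam * (w + 1 / 2) + mu) - digamma (lam / 2 + mu)) / w ^ 2 := by
  have ha := re_half_add_pos hlam hmu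
  have hl : (lam : ℂ) ≠ 0 := ofReal_ne_zero.2 hlam.ne'
  have hre : ∀ n : ℕ, 0 < (((n : ℂ) + (lam / 2 + mu)) / lam).re := by
    intro n
    rw [div_ofReal_re, add_re, natCast_re]
    positivity
  have h1 := hasLaplace_tsum_expKernel (ι := ℕ) (m := fun _ => 1)
    (β := fun n => ((n : ℂ) + (lam / 2 + mu)) / lam)
    (fun n => div_ne_zero (natCast_add_ne_zero ha n) hl) (fun n => by linarith [hre n])
    (((summable_inv_norm_sq ha).mul_left (lam ^ 2)).congr fun n => by
      rw [norm_div, div_pow, norm_real, Real.norm_eq_abs, sq_abs, norm_one]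
      field_simp)
  refine h1.congr (fun t ht => lerch_sub_eq_tsum hlam hmu ht) fun w hw => ?_
  have hz : (lam : ℂ) * (w + 1 / 2) + mu = lam * w + (lam / 2 + mu) := by ring
  have hzre : 0 < ((lam : ℂ) * w + (lam / 2 + mu)).re := by
    rw [add_re, re_ofReal_mul]
    have : 0 < w.re := by linarith
    positivity
  rw [hz, ← ((hasSum_digamma ha hzre).mul_left (lam : ℂ)).tsum_eq]
  congr 1
  refine tsum_congr fun n => ?_
  have e1 := natCast_add_ne_zero ha n
  have e2 := natCast_add_ne_zero hzre n
  have e3 : w + ((n : ℂ) + (lam / 2 + mu)) / lam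
      = ((n : ℂ) + (lam * w + (lam / 2 + mu))) / lam := by
    field_simp
    ring
  rw [e3]
  field_simp

theorem natCast_cpow_eq_exp {n : ℕ} (hn : n ≠ 0) (s : ℂ) :
    (n : ℂ) ^ s = exp (Real.log n * s) := by
  rw [cpow_def_of_ne_zero (Nat.cast_ne_zero.2 hn), natCast_log]

theorem ofReal_sqrt_eq_exp {n : ℕ} (hn : n ≠ 0) : ((√(n : ℝ) : ℝ) : ℂ) = exp (Real.log n * (1 / 2)) := by
  have h0 : (0 : ℝ) < n := by exact_mod_cast Nat.pos_of_ne_zero hn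
  rw [Real.sqrt_eq_rpow, Real.rpow_def_of_pos h0, ofReal_exp]
  push_cast
  rfl

/-- The coefficients `c(n) / √n`. -/
def coeff (c : ℕ → ℂ) (n : ℕ) : ℂ := if n = 0 then 0 else c n / (√(n : ℝ) : ℂ)

theorem coeff_mul_exp (c : ℕ → ℂ) (n : ℕ) (w : ℂ) :
    coeff c n * exp (-w * Real.log n) = LSeries.term c (w + 1 / 2) n := by
  by_cases hn : n = 0
  · simp [coeff, hn]
  · rw [coeff, if_neg hn, LSeries.term_of_ne_zero hn, natCast_cpow_eq_exp hn, ofReal_sqrt_eq_exp hn,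
      mul_add, exp_add, div_mul_eq_mul_div, neg_mul, exp_neg, mul_comm w]
    field_simp

theorem sum_coeff_eq_tsum {c : ℕ → ℂ} (h1 : c 1 = 0) (t : ℝ) :
    ∑ n ∈ Finset.Icc 2 ⌊Real.exp t⌋₊, c n / (√(n : ℝ) : ℂ) * (t - Real.log n)
      = ∑' n : ℕ, coeff c n * ((max (t - Real.log n) 0 : ℝ) : ℂ) := by
  rw [tsum_eq_sum (s := Finset.Icc 2 ⌊Real.exp t⌋₊)]
  · refine Finset.sum_congr rfl fun n hn => ?_
    rw [Finset.mem_Icc] at hn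
    have hn0 : n ≠ 0 := by omega
    have h2 : (n : ℝ) ≤ Real.exp t := (Nat.le_floor_iff (Real.exp_pos t).le).1 hn.2
    have h3 : Real.log n ≤ t := (Real.log_le_iff_le_exp (by positivity)).2 h2
    rw [coeff, if_neg hn0, max_eq_left (by linarith)]
    push_cast
    ring
  · intro n hn
    rw [Finset.mem_Icc, not_and_or, not_le, not_le] at hn
    rcases hn with hn | hn
    · interval_cases n <;> simp [coeff, h1]
    · have h2 : Real.exp t < n := (Nat.floor_lt (Real.exp_pos t).le).1 hn
      have h3 : t < Real.log n := (Real.lt_log_iff_exp_lt ((Real.exp_pos t).trans h2)).2 h2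
      rw [max_eq_right (by linarith)]
      simp

theorem hasLaplace_sum_coeff {c : ℕ → ℂ} (hc : EulerSum F c) :
    HasLaplace (fun t => ∑ n ∈ Finset.Icc 2 ⌊Real.exp t⌋₊, c n / (√(n : ℝ) : ℂ) * (t - Real.log n))
      fun w => -logDeriv F (w + 1 / 2) / w ^ 2 := by
  have h1 := HasLaplace.tsum
    (fun n : ℕ => (hasLaplace_max (L := Real.log n) (Real.log_natCast_nonneg n)).const_mul
      (coeff c n)) (fun σ hσ => ?_)
  · refine h1.congr (fun t _ => sum_coeff_eq_tsum hc.one t) fun w hw => ?_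
    have hre : 1 < (w + 1 / 2).re := by
      rw [add_re]
      norm_num
      linarith
    rw [← (hc.hasSum _ hre).LSeries_eq, LSeries, ← tsum_div_const]
    refine tsum_congr fun n => ?_
    rw [← coeff_mul_exp]
    ring
  · have hs : LSeriesSummable c ((σ : ℂ) + 1 / 2) := (hc.hasSum _ (by
      rw [add_re]
      norm_num
      linarith)).LSeriesSummable
    refine ⟨fun n => 2 * ‖LSeries.term c ((σ : ℂ) + 1 / 2) n‖, hs.norm.mul_left 2,
      fun n t ht => ?_⟩
    beta_reduce
    rw [← coeff_mul_exp, norm_mul, norm_mul, norm_real, Real.norm_eq_abs,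
      abs_of_nonneg (le_max_right _ _), ← ofReal_neg, ← ofReal_mul, norm_exp, ofReal_re]
    -- For $x=t-\log n\ge0$, $x\le2\sigma x\le2e^{\sigma x}$ since $\sigma>\tfrac12$. The resulting
    -- majorant $|c(n)|n^{-\sigma-1/2}$ is summable because $\sigma+\tfrac12>1$.
    have h2 : max (t - Real.log n) 0 ≤ 2 * (Real.exp (-σ * Real.log n) * Real.exp (σ * t)) := by
      rw [← Real.exp_add]
      refine max_le ?_ (by positivity)
      rcases le_total (t - Real.log n) 0 with h | h
      · exact h.trans (by positivity)
      · have := Real.add_one_le_exp (-σ * Real.log n + σ * t)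
        nlinarith
    calc ‖coeff c n‖ * max (t - Real.log n) 0
        ≤ ‖coeff c n‖ * (2 * (Real.exp (-σ * Real.log n) * Real.exp (σ * t))) := by gcongr
      _ = _ := by ring

/-- Each piece of $\Phi_F$ transforms to one summand of $\xi_F'/\xi_F$. The poles at $s=0$ and $s=1$
use $\beta=\tfrac12$ and $\beta=-\tfrac12$, whose constants $1/\beta$ cancel. -/
theorem hasLaplace_phiFormula {c : ℕ → ℂ} (hF : SemiExtendedSelbergClass F)
    (hG : EntireExtension F G) (hc : EulerSum F c) :
    HasLaplace (phiFormula F D c) fun w => logDeriv (xi F D) (w + 1 / 2) / w ^ 2 := by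
  have h1 := ((hasLaplace_expKernel (β := 1 / 2) (by norm_num) (by norm_num)).const_mul
      (-(poleOrder F : ℂ))).add
    ((hasLaplace_expKernel (β := -(1 / 2)) (by norm_num) (by norm_num)).const_mul
      (-(poleOrder F : ℂ)))
  have h2 := (hasLaplace_sum_coeff hc).const_mul (-1)
  have h3 := hasLaplace_ofReal.const_mul
    (Real.log D.Q + ∑ j, D.lam j * digamma (D.lam j / 2 + D.mu j))
  have h4 := HasLaplace.sum Finset.univ fun j => hasLaplace_lerch (D.lam_pos j) (D.mu_re j)
  refine (((h1.add h2).add h3).add h4).congr (fun t _ => ?_) fun w hw => ?_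
  · simp only [phiFormula, expKernel]
    have e1 : -(1 / 2 : ℂ) * (t : ℂ) = -t / 2 := by ring
    have e2 : -(-(1 / 2 : ℂ)) * (t : ℂ) = t / 2 := by ring
    rw [e1, e2]
    ring
  · have hre : 1 < (w + 1 / 2).re := by
      rw [add_re]
      norm_num
      linarith
    have hw0 : w ≠ 0 := by rintro rfl; norm_num at hw
    rw [logDeriv_xi hF hG hre, GammaData.gammaLog, ← Finset.sum_div]
    simp only [mul_sub, Finset.sum_sub_distrib]
    have e1 : w + 1 / 2 - 1 = w + -(1 / 2) := by ring
    rw [e1]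
    field_simp
    ring

end SelbergScrew
end

/-! ### Independence of the functional-equation data, and conclusion. -/

noncomputable section
namespace SelbergScrew

/-- The sum `∑ 1 / (n + x)²`. -/
def trigammaSum (x : ℝ) : ℝ := ∑' n : ℕ, 1 / ((n : ℝ) + x) ^ 2

/-- Termwise estimate of the digamma series. The Lipschitz constant tends to $0$ as $x\to\infty$,
which replaces Stirling's formula in the asymptotics below. -/
theorem norm_digamma_sub_le {x : ℝ} (hx : 0 < x) {z z' : ℂ} (hz : x ≤ z.re) (hz' : x ≤ z'.re) :
    ‖digamma z' - digamma z‖ ≤ trigammaSum x * ‖z' - z‖ := by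
  have h1 := hasSum_digamma (hx.trans_le hz) (hx.trans_le hz')
  rw [← h1.tsum_eq]
  refine tsum_of_norm_bounded ((summable_inv_sq hx).hasSum.mul_right _) fun n => ?_
  have e1 := natCast_add_ne_zero (hx.trans_le hz) n
  have e2 := natCast_add_ne_zero (hx.trans_le hz') n
  have e3 : 1 / ((n : ℂ) + z) - 1 / ((n : ℂ) + z') = (z' - z) / (((n : ℂ) + z) * ((n : ℂ) + z')) := by
    field_simp
    ring
  rw [e3, norm_div, norm_mul, one_div_mul_eq_div, sq]
  gcongr
  · exact le_trans (by gcongr) (add_re_le_norm z n)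
  · exact le_trans (by gcongr) (add_re_le_norm z' n)

theorem tendsto_trigammaSum : Tendsto trigammaSum atTop (𝓝 0) := by
  have h1 := tendsto_tsum_of_dominated_convergence (𝓕 := atTop)
    (f := fun (x : ℝ) (n : ℕ) => 1 / ((n : ℝ) + x) ^ 2) (g := fun _ => 0)
    (summable_inv_sq one_pos) (fun n => ?_) ?_
  · rw [tsum_zero] at h1
    exact h1
  · refine Tendsto.div_atTop tendsto_const_nhds ?_
    exact (tendsto_pow_atTop two_ne_zero).comp (tendsto_atTop_add_const_left _ _ tendsto_id)
  · filter_upwards [eventually_ge_atTop 1] with x hx n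
    rw [Real.norm_of_nonneg (by positivity)]
    gcongr

theorem digamma_ofReal_im {x : ℝ} (hx : 0 < x) : (digamma x).im = 0 := by
  have h1 := (continuous_im.tendsto _).comp (tendsto_digamma (s := x) (by simpa using hx))
  refine tendsto_nhds_unique h1 (tendsto_const_nhds.congr fun n => ?_)
  have h2 : log (n : ℂ) - ∑ j ∈ Finset.range (n + 1), 1 / ((j : ℂ) + x)
      = ((Real.log n - ∑ j ∈ Finset.range (n + 1), 1 / ((j : ℝ) + x) : ℝ) : ℂ) := by
    push_cast
    rfl
  rw [Function.comp_apply, h2, ofReal_im]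

namespace GammaData

variable (D : GammaData)

theorem norm_gammaLog_sub_le {x : ℝ} (hx : 0 < x) {s s' : ℂ} (hs : x ≤ s.re) (hs' : x ≤ s'.re) :
    ‖D.gammaLog s' - D.gammaLog s‖
      ≤ (∑ j, D.lam j ^ 2 * trigammaSum (D.lam j * x)) * ‖s' - s‖ := by
  unfold gammaLog
  rw [add_sub_add_left_eq_sub, ← Finset.sum_sub_distrib, Finset.sum_mul]
  refine norm_sum_le_of_le _ fun j _ => ?_
  have hl := D.lam_pos j
  have hm := D.mu_re j
  have hre : ∀ s : ℂ, x ≤ s.re → D.lam j * x ≤ ((D.lam j : ℂ) * s + D.mu j).re := by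
    intro s hs
    rw [add_re, re_ofReal_mul]
    nlinarith
  have h1 := norm_digamma_sub_le (mul_pos hl hx) (hre s hs) (hre s' hs')
  have h2 : (D.lam j : ℂ) * s' + D.mu j - (D.lam j * s + D.mu j) = D.lam j * (s' - s) := by ring
  rw [h2, norm_mul, norm_real, Real.norm_eq_abs, abs_of_pos hl] at h1
  rw [← mul_sub, norm_mul, norm_real, Real.norm_eq_abs, abs_of_pos hl]
  calc D.lam j * ‖digamma (D.lam j * s' + D.mu j) - digamma (D.lam j * s + D.mu j)‖
      ≤ D.lam j * (trigammaSum (D.lam j * x) * (D.lam j * ‖s' - s‖)) := by gcongr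
    _ = _ := by ring

theorem tendsto_sum_trigammaSum (a : Fin D.r → ℝ) :
    Tendsto (fun x => ∑ j, a j * trigammaSum (D.lam j * x)) atTop (𝓝 0) := by
  rw [← Finset.sum_const_zero (s := Finset.univ (α := Fin D.r))]
  refine tendsto_finsetSum _ fun j _ => ?_
  rw [← mul_zero (a j)]
  exact (tendsto_trigammaSum.comp (tendsto_id.const_mul_atTop (D.lam_pos j))).const_mul _

theorem tendsto_gammaLog_add_one_sub :
    Tendsto (fun x : ℝ => D.gammaLog (x + 1) - D.gammaLog x) atTop (𝓝 0) := by
  refine squeeze_zero_norm' ?_ (D.tendsto_sum_trigammaSum fun j => D.lam j ^ 2)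
  filter_upwards [eventually_gt_atTop 0] with x hx
  have := D.norm_gammaLog_sub_le hx (s := x) (s' := x + 1) (by simp) (by simp)
  simpa using this

/-- Digamma is real on the positive axis; compare $\lambda x+\mu$ with $\lambda x+\Re\mu$, which
differs from it by a fixed imaginary amount. -/
theorem tendsto_gammaLog_im : Tendsto (fun x : ℝ => (D.gammaLog x).im) atTop (𝓝 0) := by
  refine squeeze_zero_norm' ?_ (D.tendsto_sum_trigammaSum fun j => D.lam j * |(D.mu j).im|)
  filter_upwards [eventually_gt_atTop 0] with x hx
  rw [gammaLog, add_im, ofReal_im, zero_add, im_sum]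
  refine norm_sum_le_of_le _ fun j _ => ?_
  have hl := D.lam_pos j
  have hm := D.mu_re j
  have hpos : 0 < D.lam j * x := by positivity
  have h1 := norm_digamma_sub_le (x := D.lam j * x) hpos
    (z := ((D.lam j * x + (D.mu j).re : ℝ) : ℂ)) (z' := D.lam j * x + D.mu j)
    (by rw [ofReal_re]; linarith) (by rw [add_re, ← ofReal_mul, ofReal_re]; linarith)
  have h2 := (abs_im_le_norm _).trans h1
  rw [sub_im, digamma_ofReal_im (by positivity), sub_zero] at h2
  have h3 : (D.lam j : ℂ) * x + D.mu j - ((D.lam j * x + (D.mu j).re : ℝ) : ℂ)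
      = (D.mu j).im * I := by
    apply Complex.ext <;> simp
  rw [h3, norm_mul, norm_I, mul_one, norm_real, Real.norm_eq_abs] at h2
  rw [im_ofReal_mul, norm_mul, Real.norm_eq_abs, Real.norm_eq_abs, abs_of_pos hl]
  calc D.lam j * |(digamma (D.lam j * x + D.mu j)).im|
      ≤ D.lam j * (trigammaSum (D.lam j * x) * |(D.mu j).im|) := by gcongr
    _ = _ := by ring

theorem differentiableAt_gammaLog {s : ℂ} (hs : 0 < s.re) : DifferentiableAt ℂ D.gammaLog s := by
  have h1 : DifferentiableOn ℂ D.gammaFactor {s : ℂ | 0 < s.re} := fun s hs =>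
    (D.differentiableAt_gammaFactor hs).differentiableWithinAt
  have h2 : DifferentiableOn ℂ (logDeriv D.gammaFactor) {s : ℂ | 0 < s.re} :=
    (h1.deriv isOpen_re_pos).div h1 fun s hs => D.gammaFactor_ne_zero hs
  have h3 := h2.differentiableAt (isOpen_re_pos.mem_nhds hs)
  refine (Filter.EventuallyEq.differentiableAt_iff ?_).1 h3
  filter_upwards [isOpen_re_pos.mem_nhds hs] with z hz using D.logDeriv_gammaFactor hz

end GammaData

/-- A holomorphic function on `Re s > 0`, Lipschitz away from the boundary, which satisfies the
reflection formula `L(s) = -conj (L(1 - conj s))`, is constant, if its differences and imaginary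
parts tend to zero along the real axis then it vanishes. -/
theorem eq_zero_of_reflect {L : ℂ → ℂ} {K : ℝ} (hd : ∀ s : ℂ, 0 < s.re → DifferentiableAt ℂ L s)
    (hK : ∀ s s' : ℂ, 1 / 4 ≤ s.re → 1 / 4 ≤ s'.re → ‖L s' - L s‖ ≤ K * ‖s' - s‖)
    (hrefl : ∀ s : ℂ, 0 < s.re → s.re < 1 → L s = -(starRingEnd ℂ) (L (1 - (starRingEnd ℂ) s)))
    (h1 : Tendsto (fun x : ℝ => L (x + 1) - L x) atTop (𝓝 0))
    (him : Tendsto (fun x : ℝ => (L x).im) atTop (𝓝 0)) {s : ℂ} (hs : 0 < s.re) : L s = 0 := by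
  -- The reflection formula makes the two definitions agree on the overlap $0<\Re s<1$, so $E$ is
  -- entire.
  let E : ℂ → ℂ := fun s => if 0 < s.re then L s else -(starRingEnd ℂ) (L (1 - (starRingEnd ℂ) s))
  have hE1 : ∀ s : ℂ, 0 < s.re → E s = L s := fun s hs => if_pos hs
  have hE2 : ∀ s : ℂ, s.re < 1 → E s = -(starRingEnd ℂ) (L (1 - (starRingEnd ℂ) s)) := by
    intro s hs
    by_cases h : 0 < s.re
    · rw [hE1 s h, hrefl s h hs]
    · exact if_neg h
  have hEd : Differentiable ℂ E := by
    intro s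
    rcases lt_or_ge 0 s.re with h | h
    · refine (Filter.EventuallyEq.differentiableAt_iff ?_).1 (hd s h)
      filter_upwards [isOpen_re_pos.mem_nhds h] with z hz using (hE1 z hz).symm
    · have h2 : DifferentiableAt ℂ (fun z => L (1 - z)) ((starRingEnd ℂ) s) := by
        refine DifferentiableAt.comp (g := L) _ (hd _ ?_) (by fun_prop)
        simp
        linarith
      refine (Filter.EventuallyEq.differentiableAt_iff ?_).1 (differentiableAt_conj_conj_iff.2 h2).neg
      filter_upwards [(isOpen_lt continuous_re continuous_const).mem_nhds
        (show s.re < 1 by linarith)] with z hz using (hE2 z hz).symm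
  have hK0 : 0 ≤ K := by
    have := (norm_nonneg _).trans (hK 1 2 (by norm_num) (by norm_num))
    norm_num at this
    exact this
  -- The regions $\Re s>\tfrac14$ and $\Re s<\tfrac34$ cover the plane and are exchanged by
  -- $s\mapsto1-\bar s$, so one Lipschitz constant works everywhere; by Liouville, $E'$ is constant.
  have hbd : ∀ s, ‖deriv E s‖ ≤ K := by
    intro s
    refine norm_deriv_le_of_lip' hK0 ?_
    rcases lt_or_ge (1 / 4) s.re with h | h
    · filter_upwards [(isOpen_lt continuous_const continuous_re).mem_nhds h] with z hz
      have hz' : 1 / 4 < z.re := hz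
      rw [hE1 z (by linarith), hE1 s (by linarith)]
      exact hK s z h.le hz'.le
    · filter_upwards [(isOpen_lt continuous_re continuous_const).mem_nhds
        (show s.re < 3 / 4 by linarith)] with z hz
      have hz' : z.re < 3 / 4 := hz
      rw [hE2 z (by linarith), hE2 s (by linarith), neg_sub_neg, ← map_sub, norm_conj,
        norm_sub_rev]
      refine (hK _ _ ?_ ?_).trans (le_of_eq ?_)
      · simp; linarith
      · simp; linarith
      · rw [sub_sub_sub_cancel_left, ← map_sub, norm_conj, norm_sub_rev]
  have hdE : Differentiable ℂ (deriv E) := by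
    have h3 : DifferentiableOn ℂ E Set.univ := hEd.differentiableOn
    exact differentiableOn_univ.1 (h3.deriv isOpen_univ)
  have hconst : ∀ s, deriv E s = deriv E 0 := fun s => hdE.apply_eq_apply_of_bounded
    (isBounded_iff_forall_norm_le.2 ⟨K, by rintro _ ⟨z, rfl⟩; exact hbd z⟩) s 0
  have hlin : ∀ s, E s - deriv E 0 * s = E 0 - deriv E 0 * 0 := fun s =>
    is_const_of_deriv_eq_zero (f := fun s => E s - deriv E 0 * s) (by fun_prop) (fun z => by
      rw [deriv_fun_sub (hEd z) (by fun_prop), hconst z]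
      simp) s 0
  -- The slope of the affine function $E$ is $E(x+1)-E(x)$, which tends to $0$.
  have hc : deriv E 0 = 0 := by
    refine (tendsto_nhds_unique (h1.congr' (f₂ := fun _ => deriv E 0) ?_)
      tendsto_const_nhds).symm
    filter_upwards [eventually_gt_atTop 0] with x hx
    rw [← hE1 (x + 1) (by simp; linarith), ← hE1 x (by simpa using hx)]
    have e1 := hlin (x + 1)
    have e2 := hlin x
    linear_combination e1 - e2
  have hEc : ∀ s, E s = E 0 := fun s => by
    have := hlin s
    rw [hc] at this
    simpa using this
  have him0 : (E 0).im = 0 := by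
    refine (tendsto_nhds_unique (him.congr' (f₂ := fun _ => (E 0).im) ?_)
      tendsto_const_nhds).symm
    filter_upwards [eventually_gt_atTop 0] with x hx
    rw [← hE1 x (by simpa using hx), hEc]
  -- Reflection at $s=0$ reads $E(0)=-\overline{E(1)}$; for a constant this says that the real part
  -- vanishes.
  have hre0 : (E 0).re = 0 := by
    have e1 := hE2 0 (by simp)
    rw [map_zero, sub_zero, ← hE1 1 (by simp), hEc 1] at e1
    have := congrArg re e1
    simp at this
    linarith
  rw [← hE1 s hs, hEc]
  exact Complex.ext hre0 him0

variable {F G : ℂ → ℂ} {D D' : GammaData}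

theorem logDeriv_xi_reflect (hG : EntireExtension F G) (hD : FunctionalEquation F D) (s : ℂ) :
    logDeriv (xi F D) s = -(starRingEnd ℂ) (logDeriv (xi F D) (1 - (starRingEnd ℂ) s)) := by
  have hω : D.ω ≠ 0 := norm_pos_iff.1 (by rw [D.norm_ω]; exact one_pos)
  have hd := differentiable_xi hG hD
  have h1 : HasDerivAt (fun z => xi F D (1 - z))
      (-deriv (xi F D) (1 - (starRingEnd ℂ) s)) ((starRingEnd ℂ) s) := by
    have := (hd (1 - (starRingEnd ℂ) s)).hasDerivAt.comp_const_sub 1 ((starRingEnd ℂ) s)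
    exact this
  have h2 : HasDerivAt (xi F D)
      (D.ω * (starRingEnd ℂ) (-deriv (xi F D) (1 - (starRingEnd ℂ) s))) s := by
    have h3 := (h1.conj_conj).const_mul D.ω
    rw [conj_conj] at h3
    refine h3.congr_of_eventuallyEq (Eventually.of_forall fun z => ?_)
    exact hD z
  rw [logDeriv_apply, logDeriv_apply, h2.deriv]
  conv_lhs => rw [hD s]
  rw [mul_div_mul_left _ _ hω, map_div₀, map_neg, neg_div]

/-- The functions $\xi_F$ for two data differ by the quotient of the gamma factors, which is
holomorphic and zero-free for $\Re s>0$. -/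
theorem logDeriv_xi_sub (hG : EntireExtension F G) {s : ℂ} (hs : 0 < s.re)
    (hD' : FunctionalEquation F D') (h0 : xi F D' s ≠ 0) :
    logDeriv (xi F D) s = logDeriv (xi F D') s + (D.gammaLog s - D'.gammaLog s) := by
  have h1 : xi F D =ᶠ[𝓝 s] fun z => xi F D' z * (D.gammaFactor z / D'.gammaFactor z) := by
    filter_upwards [isOpen_re_pos.mem_nhds hs] with z hz
    have := D'.gammaFactor_ne_zero hz
    rw [xi_eq_xiRight hG hz, xi_eq_xiRight hG hz, xiRight, xiRight]
    field_simp
  have h2 : logDeriv (xi F D) s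
      = logDeriv (fun z => xi F D' z * (D.gammaFactor z / D'.gammaFactor z)) s := by
    rw [logDeriv_apply, logDeriv_apply, h1.deriv_eq, h1.eq_of_nhds]
  have hγ := D.gammaFactor_ne_zero hs
  have hγ' := D'.gammaFactor_ne_zero hs
  have hdγ := D.differentiableAt_gammaFactor hs
  have hdγ' := D'.differentiableAt_gammaFactor hs
  rw [h2, logDeriv_mul (f := xi F D') (g := fun z => D.gammaFactor z / D'.gammaFactor z) s h0
    (div_ne_zero hγ hγ') (differentiable_xi hG hD' s) (hdγ.div hdγ' hγ'),
    logDeriv_div (f := D.gammaFactor) (g := D'.gammaFactor) s hγ hγ' hdγ hdγ',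
    D.logDeriv_gammaFactor hs, D'.logDeriv_gammaFactor hs]

/-- The logarithmic derivative of the gamma factor is determined by the function `F`. -/
theorem gammaLog_eq (hF : SemiExtendedSelbergClass F) (hG : EntireExtension F G)
    (hD : FunctionalEquation F D) (hD' : FunctionalEquation F D') {s : ℂ} (hs : 0 < s.re) :
    D.gammaLog s = D'.gammaLog s := by
  let L : ℂ → ℂ := fun s => D.gammaLog s - D'.gammaLog s
  have hd : ∀ s : ℂ, 0 < s.re → DifferentiableAt ℂ L s := fun s hs =>
    (D.differentiableAt_gammaLog hs).sub (D'.differentiableAt_gammaLog hs)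
  have hrefl0 : ∀ s : ℂ, 0 < s.re → s.re < 1 → xi F D' s ≠ 0 →
      L s = -(starRingEnd ℂ) (L (1 - (starRingEnd ℂ) s)) := by
    intro s hs hs1 h0
    have hs' : 0 < (1 - (starRingEnd ℂ) s).re := by simp; linarith
    have h0' : xi F D' (1 - (starRingEnd ℂ) s) ≠ 0 := by
      rwa [← norm_ne_zero_iff, ← norm_xi_reflect hD', norm_ne_zero_iff]
    have e1 := logDeriv_xi_sub (D := D) hG hs hD' h0
    have e2 := logDeriv_xi_sub (D := D) hG hs' hD' h0'
    rw [logDeriv_xi_reflect hG hD, logDeriv_xi_reflect hG hD', e2, map_add] at e1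
    simp only [L]
    linear_combination -e1
  have hrefl : ∀ s : ℂ, 0 < s.re → s.re < 1 →
      L s = -(starRingEnd ℂ) (L (1 - (starRingEnd ℂ) s)) := by
    intro s hs hs1
    have hs' : 0 < (1 - (starRingEnd ℂ) s).re := by simp; linarith
    have c1 : Tendsto L (𝓝[≠] s) (𝓝 (L s)) :=
      (hd s hs).continuousAt.tendsto.mono_left nhdsWithin_le_nhds
    have c2 : Tendsto (fun s => -(starRingEnd ℂ) (L (1 - (starRingEnd ℂ) s))) (𝓝[≠] s)
        (𝓝 (-(starRingEnd ℂ) (L (1 - (starRingEnd ℂ) s)))) := by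
      have h3 : ContinuousAt (fun s : ℂ => 1 - (starRingEnd ℂ) s) s := by fun_prop
      have h4 : ContinuousAt (fun s : ℂ => L (1 - (starRingEnd ℂ) s)) s :=
        ContinuousAt.comp (g := L) (hd _ hs').continuousAt h3
      have h5 := (continuous_conj.continuousAt.comp h4).neg
      exact h5.tendsto.mono_left nhdsWithin_le_nhds
    -- Zeros of $\xi_F$ are isolated and both sides are continuous, so the reflection formula
    -- extends across them.
    refine tendsto_nhds_unique c1 (c2.congr' ?_)
    have hne : ∀ᶠ z in 𝓝[≠] s, xi F D' z ≠ 0 := by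
      have hdx := differentiable_xi hG hD'
      refine ((hdx.analyticAt s).eventually_eq_zero_or_eventually_ne_zero).resolve_left fun h => ?_
      exact analyticOrderAt_ne_top_of_entire hdx (exists_xi_ne_zero hF hG) s
        (analyticOrderAt_eq_top.2 h)
    filter_upwards [hne, nhdsWithin_le_nhds (isOpen_re_pos.mem_nhds hs), nhdsWithin_le_nhds
      ((isOpen_lt continuous_re continuous_const).mem_nhds hs1)] with z h0 hz hz1
    exact (hrefl0 z hz hz1 h0).symm
  refine sub_eq_zero.1 (eq_zero_of_reflect (L := L)
    (K := (∑ j, D.lam j ^ 2 * trigammaSum (D.lam j * (1 / 4)))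
      + ∑ j, D'.lam j ^ 2 * trigammaSum (D'.lam j * (1 / 4))) hd (fun s s' h h' => ?_) hrefl
      ?_ ?_ hs)
  · have e1 := D.norm_gammaLog_sub_le (by norm_num) h h'
    have e2 := D'.norm_gammaLog_sub_le (by norm_num) h h'
    have e3 : L s' - L s
        = (D.gammaLog s' - D.gammaLog s) - (D'.gammaLog s' - D'.gammaLog s) := by
      simp only [L]; ring
    rw [e3, add_mul]
    exact (norm_sub_le _ _).trans (add_le_add e1 e2)
  · have := D.tendsto_gammaLog_add_one_sub.sub D'.tendsto_gammaLog_add_one_sub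
    rw [sub_zero] at this
    refine this.congr fun x => ?_
    simp only [L]
    ring
  · have := D.tendsto_gammaLog_im.sub D'.tendsto_gammaLog_im
    rw [sub_zero] at this
    exact this.congr fun x => by simp only [L, sub_im]

theorem phiFormula_eq_neg_screwFormula {c : ℕ → ℂ} (hF : SemiExtendedSelbergClass F)
    (hD : FunctionalEquation F D) (hc : EulerSum F c) {t : ℝ} (ht : 0 ≤ t) :
    phiFormula F D c t = -screwFormula F D t := by
  obtain ⟨G, hG⟩ := hF.toExtendedSelbergClass.exists_entireExtension
  obtain ⟨f, B, h⟩ := exists_shiftedXi hF hG hD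
  have h1 := (hasLaplace_phiFormula (D := D) hF hG hc).add h.hasLaplace_screwFormula
  exact eq_neg_of_add_eq_zero_left (h1.eq_zero (fun w _ => by ring)
    (by rw [phiFormula_zero, screwFormula_zero, add_zero]) ht)

/-- The transform of $\Phi_F$ involves the data only through `gammaLog` and does not involve $c$ at
all. -/
theorem phiFormula_eq {c c' : ℕ → ℂ} (hF : SemiExtendedSelbergClass F)
    (hD : FunctionalEquation F D) (hD' : FunctionalEquation F D') (hc : EulerSum F c)
    (hc' : EulerSum F c') {t : ℝ} (ht : 0 ≤ t) : phiFormula F D c t = phiFormula F D' c' t := by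
  obtain ⟨G, hG⟩ := hF.toExtendedSelbergClass.exists_entireExtension
  have h1 := (hasLaplace_phiFormula (D := D) hF hG hc).add
    ((hasLaplace_phiFormula (D := D') hF hG hc').const_mul (-1))
  have h2 := h1.eq_zero (fun w hw => by
    have hre : 1 < (w + 1 / 2).re := by
      rw [add_re]
      norm_num
      linarith
    rw [logDeriv_xi hF hG hre, logDeriv_xi hF hG hre, gammaLog_eq hF hG hD hD' (by linarith)]
    ring) (by rw [phiFormula_zero, phiFormula_zero]; ring) ht
  linear_combination h2

end SelbergScrew
end

theorem theorem4p1 (F : ℂ → ℂ) (hF : SelbergScrew.SemiExtendedSelbergClass F) :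
    -- the Lerch series and the objects defining `g_F` make sense, for all admissible data
    (∀ D : SelbergScrew.GammaData, SelbergScrew.FunctionalEquation F D →
      (∀ j, ∀ t : ℝ, 0 ≤ t →
        Summable (SelbergScrew.lerchTerm (Complex.exp (-t / D.lam j)) 2
          (D.lam j / 2 + D.mu j))) ∧
      Differentiable ℂ (SelbergScrew.xi F D) ∧
      Filter.Tendsto (SelbergScrew.xiLogDerivReg F D) (nhdsWithin (1 / 2 : ℂ) {1 / 2}ᶜ)
        (nhds (SelbergScrew.iB F D)) ∧
      (∀ t : ℝ, Summable fun γ : SelbergScrew.nonzeroZeros F D =>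
        SelbergScrew.zeroTerm F D t γ)) ∧
    -- `Φ_F` depends only on `F`
    (∀ (D D' : SelbergScrew.GammaData) (c c' : ℕ → ℂ),
      SelbergScrew.FunctionalEquation F D → SelbergScrew.FunctionalEquation F D' →
      SelbergScrew.EulerSum F c → SelbergScrew.EulerSum F c' →
      ∀ t : ℝ, SelbergScrew.phi F D c t = SelbergScrew.phi F D' c' t) ∧
    -- `Φ_F = -g_F`
    (∀ (D : SelbergScrew.GammaData) (c : ℕ → ℂ),
      SelbergScrew.FunctionalEquation F D → SelbergScrew.EulerSum F c →
      ∀ t : ℝ, SelbergScrew.phi F D c t = -SelbergScrew.screw F D t) := by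
  refine ⟨fun D hD => ?_, fun D D' c c' hD hD' hc hc' t => ?_, fun D c hD hc t => ?_⟩
  · obtain ⟨G, hG⟩ := hF.toExtendedSelbergClass.exists_entireExtension
    obtain ⟨f, B, h⟩ := SelbergScrew.exists_shiftedXi hF hG hD
    refine ⟨fun j t ht => ?_, SelbergScrew.differentiable_xi hG hD, ?_, h.summable_zeroTerm⟩
    · exact SelbergScrew.summable_lerchTerm
        (SelbergScrew.re_half_add_pos (D.lam_pos j) (D.mu_re j))
        (SelbergScrew.norm_exp_neg_div_le ht (D.lam_pos j))
    · rw [h.iB_eq]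
      exact h.tendsto_iB
  · unfold SelbergScrew.phi
    split_ifs with ht
    · exact SelbergScrew.phiFormula_eq hF hD hD' hc hc' ht
    · rw [SelbergScrew.phiFormula_eq hF hD hD' hc hc' (by linarith)]
  · unfold SelbergScrew.phi SelbergScrew.screw
    split_ifs with ht
    · exact SelbergScrew.phiFormula_eq_neg_screwFormula hF hD hc ht
    · rw [SelbergScrew.phiFormula_eq_neg_screwFormula hF hD hc (by linarith), map_neg]
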